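/- For $n\in\mathbb Z$ put $\llbracket n\rrbracket=(v^n-v^{-n})/(v-v^{-1})\in\mathbb Q(v)$. Let $d\in\mathbb N$. For a finite field $\mathbb F_q$ with $q$ odd, equip $\mathbb F_q^{2d+1}$ with a nondegenerate symmetric bilinear form and let $X$ be the set of flags $V=(0=V_0\subseteq V_1\subseteq V_2\subseteq V_3=\mathbb F_q^{2d+1})$ with $V_i=V_{3-i}^{\perp}$. The orbits $\mathcal O_A$ of the orthogonal group on $X\times X$ are indexed by the set $\Xi_d$ of $3\times 3$ matrices $A=(a_{ij})$ over $\mathbb N$ with $\sum_{i,j} a_{ij}=2d+1$ and $a_{ij}=a_{4-i,4-j}$, where $(V,V')\in\mathcal O_A$ means $a_{ij}=\dim\frac{V_{i-1}+V_i\cap V'_j}{V_{i-1}+V_i\cap V'_{j-1}}$ for all $i,j$. Let $\mathbf S^{\jmath}_{3,d}$ be the generic convolution algebra of $X\times X$: the $\mathbb Q(v)$-vector space with basis $(e_A)_{A\in\Xi_d}$ and product $e_A*e_B=\sum_C g_{A,B}^C\,e_C$, where $g_{A,B}^C\in\mathbb Z[v^2]$ is the polynomial whose value at $v=\sqrt q$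 is, for every odd prime power $q$ and every $(V,V'')\in\mathcal O_C$, the number of $V'\in X$ with $(V,V')\in\mathcal O_A$ and $(V',V'')\in\mathcal O_B$. Write elements of $\mathbf S^{\jmath}_{3,d}$ as invariant functions on $X\times X$, and put $\lambda'_a=\dim V'_a/V'_{a-1}$. Let $\mathbf e$ be the function with $\mathbf e(V,V')=v^{-\lambda'_2}$ if $V_1\subset V'_1$ has codimension $1$ and $0$ otherwise; $\mathbf f$ the function with $\mathbf f(V,V')=v^{-\lambda'_1}$ if $V'_1\subset V_1$ has codimension $1$ and $0$ otherwise; $\mathbf d_a^{\pm1}(V,V')=v^{\mp\lambda'_a}\delta_{V,V'}$ and $\mathbf k=\mathbf d_1\mathbf d_2^{-1}$. Let $\mathbf j_d=e_{\mathrm{diag}(d,1,d)}$, an idempotent, let $\mathbf S^{\imath}_{2,d}=\mathbf j_d\,\mathbf S^{\jmath}_{3,d}\,\mathbf j_d$ (an algebra with identity $\mathbf j_d$), and let $$\mathbf t_d=\Big(\mathbf f\mathbf e+\frac{\mathbf k-\mathbf k^{-1}}{v-v^{-1}}\Big)\mathbf j_d .$$ **Proposition.** $\mathbf t_d\in \mathbf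 S^{\imath}_{2,d}$, and the assignment $t\mapsto\mathbf t_d$ induces an isomorphism of unital $\mathbb Q(v)$-algebras $$\mathbb Q(v)[t]\big/\big((t+\llbracket d-1\rrbracket)(t+\llbracket d-3\rrbracket)\cdots(t+\llbracket -d-1\rrbracket)\big)\;\xrightarrow{\ \sim\ }\;\mathbf S^{\imath}_{2,d},$$ where the product has the $d+1$ factors $t+\llbracket d-1-2i\rrbracket$, $0\le i\le d$. -/

import Mathlib

open Polynomial

noncomputable section

namespace JSchur

/-! ### Isotropic flags over a finite field and their relative positions -/

/-- The nondegenerate symmetric bilinear form `(x, y) ↦ ∑ i, x i * y (2d - i)` on `F ^ (2d + 1)`. -/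
def form (F : Type) [Field F] (d : ℕ) : LinearMap.BilinForm F (Fin (2 * d + 1) → F) :=
  Matrix.toBilin' (Matrix.of fun i j => if j = Fin.rev i then (1 : F) else 0)

/-- The set `X` of flags `0 = V 0 ⊆ V 1 ⊆ V 2 ⊆ V 3 = F ^ (2d + 1)` such that
`V i` is the orthogonal complement of `V (3 - i)` for all `i`. -/
@[ext]
structure IsoFlag (F : Type) [Field F] (d : ℕ) where
  V : Fin 4 → Submodule F (Fin (2 * d + 1) → F)
  mono : Monotone V
  bot : V 0 = ⊥
  top : V 3 = ⊤
  orth : ∀ i, V i = (form F d).orthogonal (V (Fin.rev i))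

/-- The relative position of two flags `V`, `V'`, the matrix with entries (for `i, j = 1, 2, 3`)
`a i j = dim (V (i-1) + V i ∩ V' j) / (V (i-1) + V i ∩ V' (j-1))`; in the code the
indices of the matrix start at `0`. -/
def relPos {F : Type} [Field F] {d : ℕ} (V V' : IsoFlag F d) : Matrix (Fin 3) (Fin 3) ℕ :=
  Matrix.of fun i j =>
    Module.finrank F ↥(V.V i.castSucc ⊔ (V.V i.succ ⊓ V'.V j.succ)) -
      Module.finrank F ↥(V.V i.castSucc ⊔ (V.V i.succ ⊓ V'.V j.castSucc))

/-- The index set of the orbits of the orthogonal group `O(2d+1)` on `X × X`: the `3 × 3`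
matrices over `ℕ` with sum of entries `2d + 1` that are invariant under the
rotation `(i, j) ↦ (4 - i, 4 - j)`. The orbit of index `A` is the set of pairs of
flags whose relative position is `A`. -/
def Xi (d : ℕ) : Type :=
  {A : Matrix (Fin 3) (Fin 3) ℕ //
    (∑ i, ∑ j, A i j = 2 * d + 1) ∧ ∀ i j, A i j = A (Fin.rev i) (Fin.rev j)}

instance (d : ℕ) : Finite (Xi d) := by
  let f : Xi d → (Fin 3 → Fin 3 → Fin (2 * d + 2)) := fun A i j =>
    ⟨A.1 i j, by
      have h1 : A.1 i j ≤ ∑ j, A.1 i j :=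
        Finset.single_le_sum (f := fun j => A.1 i j) (fun _ _ => Nat.zero_le _)
          (Finset.mem_univ j)
      have h2 : ∑ j, A.1 i j ≤ ∑ i, ∑ j, A.1 i j :=
        Finset.single_le_sum (f := fun i => ∑ j, A.1 i j) (fun _ _ => Nat.zero_le _)
          (Finset.mem_univ i)
      have h3 := A.2.1
      omega⟩
  refine Finite.of_injective f fun A B h => Subtype.ext ?_
  ext i j
  exact congrArg Fin.val (congrFun (congrFun h i) j)

instance (d : ℕ) : Fintype (Xi d) := Fintype.ofFinite _

instance (d : ℕ) : DecidableEq (Xi d) := Classical.decEq _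

/-! ### The generic convolution algebra -/

/-- The field `ℚ(v)`. -/
abbrev K : Type := RatFunc ℚ

/-- The indeterminate `v`. -/
def v : K := RatFunc.X

/-- `p` counts convolutions: for every finite field `F` with `q` elements, `q` odd, and every pair
`(V, V'')` in the orbit of index `C`, the number of flags `V'` with `(V, V')` in the orbit of
index `A` and `(V', V'')` in the orbit of index `B` is `p(q)`. In other words, `p(q)` is the
coefficient of the characteristic function of the orbit `C` in the convolution product of the
characteristic functions of the orbits `A` and `B`. -/
def IsStructurePolynomial {d : ℕ} (A B C : Xi d) (p : ℚ[X]) : Prop :=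
  ∀ (F : Type) [Field F] [Finite F], (2 : F) ≠ 0 →
    ∀ V V'' : IsoFlag F d, relPos V V'' = C.1 →
      (Nat.card {V' : IsoFlag F d // relPos V V' = A.1 ∧ relPos V' V'' = B.1} : ℚ) =
        p.eval (Nat.card F : ℚ)

open Classical in
/-- The generic structure constant `g_{A,B}^C`, an element of `ℚ(v)`: the value at `q = v ^ 2` of
the (unique) structure polynomial of `A`, `B`, `C`. -/
def structureConst {d : ℕ} (A B C : Xi d) : K :=
  if h : ∃ p : ℚ[X], IsStructurePolynomial A B C p then aeval (v ^ 2) h.choose else 0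

end JSchur

open JSchur

/-- The algebra `S^ȷ_{3,d}` over `ℚ(v)`: the `ℚ(v)`-vector space with basis the characteristic
functions `e_A` of the orbits, `A ∈ Ξ_d` (an element is written as the family of its
coefficients), with the generic convolution product `e_A * e_B = ∑ C, g_{A,B}^C e_C`. -/
def JSchurAlgebra (d : ℕ) : Type := Xi d → K

namespace JSchur

instance (d : ℕ) : AddCommGroup (JSchurAlgebra d) := inferInstanceAs (AddCommGroup (Xi d → K))

instance (d : ℕ) : Module K (JSchurAlgebra d) := inferInstanceAs (Module K (Xi d → K))

instance (d : ℕ) : Mul (JSchurAlgebra d) where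
  mul x y := fun C => ∑ A, ∑ B, x A * y B * structureConst A B C

/-- Distributivity is all that is recorded here: associativity, which is that of the convolution
products over the finite fields, is not needed to speak about the algebra. -/
instance (d : ℕ) : NonUnitalNonAssocRing (JSchurAlgebra d) where
  left_distrib x y z := by
    funext C
    change ∑ A, ∑ B, x A * (y B + z B) * structureConst A B C =
      (∑ A, ∑ B, x A * y B * structureConst A B C) + ∑ A, ∑ B, x A * z B * structureConst A B C
    simp only [mul_add, add_mul, Finset.sum_add_distrib]
  right_distrib x y z := by
    funext C
    change ∑ A, ∑ B, (x A + y A) * z B * structureConst A B C =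
      (∑ A, ∑ B, x A * z B * structureConst A B C) + ∑ A, ∑ B, y A * z B * structureConst A B C
    simp only [add_mul, Finset.sum_add_distrib]
  zero_mul x := by
    funext C
    change ∑ A, ∑ B, (0 : K) * x B * structureConst A B C = 0
    simp
  mul_zero x := by
    funext C
    change ∑ A, ∑ B, x A * (0 : K) * structureConst A B C = 0
    simp

/-! ### The generators and the corner -/

/-- The basis element `e_A`, the characteristic function of the orbit of index `A`. -/
def basisElt {d : ℕ} (A : Xi d) : JSchurAlgebra d := fun B => if B = A then 1 else 0

/-- The sum of the `a`-th column of `A`; it is `λ'_a = dim V' a / V' (a-1)` for every pair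
`(V, V')` in the orbit of index `A`. -/
def colSum {d : ℕ} (A : Xi d) (a : Fin 3) : ℕ := ∑ i, A.1 i a

open Classical in
/-- The generator `e`, the function with value `v ^ (-λ'_2)` at `(V, V')` if `V 1 ⊂ V' 1` has
codimension `1`, and `0` otherwise. The condition on `(V, V')` says that the off-diagonal
part of its relative position is `E_{21} + E_{23}`. -/
def e (d : ℕ) : JSchurAlgebra d := fun A =>
  if ∀ i j, i ≠ j → A.1 i j = if i = 1 then 1 else 0 then v ^ (-(colSum A 1 : ℤ)) else 0

open Classical in
/-- The generator `f`, the function with value `v ^ (-λ'_1)` at `(V, V')` if `V' 1 ⊂ V 1` has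
codimension `1`, and `0` otherwise. The condition on `(V, V')` says that the off-diagonal
part of its relative position is `E_{12} + E_{32}`. -/
def f (d : ℕ) : JSchurAlgebra d := fun A =>
  if ∀ i j, i ≠ j → A.1 i j = if j = 1 then 1 else 0 then v ^ (-(colSum A 0 : ℤ)) else 0

open Classical in
/-- `dPow d a m` is the `m`-th power of the generator `d_a`, the function with value
`v ^ (-λ'_a)` at `(V, V')` if `V = V'` (that is, if the relative position is a diagonal
matrix), and `0` otherwise. -/
def dPow (d : ℕ) (a : Fin 3) (m : ℤ) : JSchurAlgebra d := fun A =>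
  if ∀ i j, i ≠ j → A.1 i j = 0 then v ^ (-(m * colSum A a)) else 0

/-- `k = d_1 d_2⁻¹`. -/
def k (d : ℕ) : JSchurAlgebra d := dPow d 0 1 * dPow d 1 (-1)

/-- `k⁻¹ = d_1⁻¹ d_2`. -/
def kInv (d : ℕ) : JSchurAlgebra d := dPow d 0 (-1) * dPow d 1 1

/-- The diagonal matrix `A_{d,0} = diag(d, 1, d)`. -/
def diagIdx (d : ℕ) : Xi d :=
  ⟨!![d, 0, 0; 0, 1, 0; 0, 0, d], by
    refine ⟨?_, ?_⟩
    · simp [Fin.sum_univ_three]; ring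
    · intro i j; fin_cases i <;> fin_cases j <;> rfl⟩

/-- The idempotent `j_d = [A_{d,0}]`. For a diagonal matrix `A` the standard basis
element `[A]` is `e_A`. -/
def j (d : ℕ) : JSchurAlgebra d := basisElt (diagIdx d)

/-- The corner `S^ı_{2,d} = j_d S^ȷ_{3,d} j_d`. -/
def iSchur (d : ℕ) : Set (JSchurAlgebra d) := {x | ∃ s : JSchurAlgebra d, x = j d * s * j d}

/-- `t_d = (f e + (k - k⁻¹) / (v - v⁻¹)) j_d`. -/
def t (d : ℕ) : JSchurAlgebra d :=
  (f d * e d + (v - v⁻¹)⁻¹ • (k d - kInv d)) * j d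

/-- The quantum integer `(v ^ n - v ^ (-n)) / (v - v⁻¹)`. -/
def qInt (n : ℤ) : K := (v ^ n - v ^ (-n)) / (v - v⁻¹)

/-- The polynomial `(t + [d-1]) (t + [d-3]) ⋯ (t + [-d-1])`, with `d + 1` factors. -/
def defPoly (d : ℕ) : K[X] :=
  ∏ i ∈ Finset.range (d + 1), (X + C (qInt ((d : ℤ) - 1 - 2 * i)))

end JSchur

end

open Polynomial

noncomputable section

namespace JSchur

/-! The corner consists of the functions on pairs of maximal isotropic subspaces that depend only on
the distance `m = d - dim (V ∩ W)`, so it is a generic form of the Bose–Mesner algebra of the dual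
polar graph and has dimension `d + 1`. This graph is distance-regular: with `[n]` the `q`-integer, a
vertex at distance `m` from a fixed one has `[m]` neighbours closer, `(q - 1)[m]` at the same
distance and `q[d] - q[m]` further away (`IsMaxIso.sum_neighbours`). Hence all convolution is
governed by one tridiagonal operator `adjOp`, and `[i]!` times the operator of the distance-`i`
graph is an explicit polynomial in it (`distOp`, `qFact_mul_card`).

The passage to generic `v` rests on two facts. Every index occurs as a relative position over every
field (`exists_relPos_eq`), so structure polynomials are unique. The quotients by `[i]!` are
polynomials in `q`, because divisibility at all odd primes forces divisibility in `ℤ[X]`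
(`dvd_of_eval_primes`). Together they give `qFact_mul_structureConst`.

The product `f e` passes through a common hyperplane of two maximal isotropic subspaces. It is
therefore `v^(-d)` times (adjacency `+ [d]`) on the corner, while the torus term contributes the
scalar `-⟦d-1⟧`; so `t_d` is an affine function of adjacency (`t_eq_cornerMap`). Adjacency is
triangular on the powers of `q^(-m)`, with diagonal entries `q[d-k] - [k]` for `0 ≤ k ≤ d`, and the
affine change turns these into `-⟦2k-d-1⟧`, the roots of `defPoly` (`adjOp_pow`, `eigenVal_eq`). So
`defPoly` annihilates `t_d`. Since the distance operators are polynomials in adjacency, `t_d`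
generates the corner, and both sides have dimension `d + 1`, so the surjection is an isomorphism.

Associativity of the big algebra is never used: polynomials in `t_d` are evaluated as operators
applied to the delta function at distance `0`, which represents `j_d`. -/

/-! ### The tridiagonal operator of the dual polar graph -/

section Operator

variable {R : Type*} [CommRing R]

/-- The `q`-integer `1 + q + ⋯ + q ^ (n - 1)`. -/
def qNat (q : R) (n : ℕ) : R := ∑ i ∈ Finset.range n, q ^ i

@[simp] lemma qNat_zero (q : R) : qNat q 0 = 0 := by simp [qNat]

@[simp] lemma qNat_one (q : R) : qNat q 1 = 1 := by simp [qNat]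

lemma sub_one_mul_qNat (q : R) (n : ℕ) : (q - 1) * qNat q n = q ^ n - 1 := by
  rw [qNat, mul_comm, geom_sum_mul]

lemma map_qNat {S : Type*} [CommRing S] (φ : R →+* S) (q : R) (n : ℕ) :
    φ (qNat q n) = qNat (φ q) n := by
  simp [qNat, map_sum, map_pow]

/-- The `q`-factorial. -/
def qFact (q : R) (n : ℕ) : R := ∏ i ∈ Finset.range n, qNat q (i + 1)

@[simp] lemma qFact_zero (q : R) : qFact q 0 = 1 := by simp [qFact]

lemma qFact_succ (q : R) (n : ℕ) : qFact q (n + 1) = qFact q n * qNat q (n + 1) := by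
  rw [qFact, Finset.prod_range_succ, qFact]

lemma map_qFact {S : Type*} [CommRing S] (φ : R →+* S) (q : R) (n : ℕ) :
    φ (qFact q n) = qFact (φ q) n := by
  simp [qFact, map_prod, map_qNat]

/-- The number of neighbours at the same distance. -/
def stayCoeff (q : R) (m : ℕ) : R := (q - 1) * qNat q m

/-- The number of neighbours further away. -/
def awayCoeff (q : R) (d m : ℕ) : R := q * qNat q d - q * qNat q m

/-- The adjacency operator of the dual polar graph of rank `d`, acting on functions of the
distance to a fixed vertex. -/
def adjOp (q : R) (d : ℕ) : Module.End R (ℕ → R) where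
  toFun g m := qNat q m * g (m - 1) + stayCoeff q m * g m + awayCoeff q d m * g (m + 1)
  map_add' g h := by funext m; simp only [Pi.add_apply]; ring
  map_smul' c g := by
    funext m; simp only [Pi.smul_apply, smul_eq_mul, RingHom.id_apply]; ring

lemma adjOp_apply (q : R) (d : ℕ) (g : ℕ → R) (m : ℕ) :
    adjOp q d g m =
      qNat q m * g (m - 1) + stayCoeff q m * g m + awayCoeff q d m * g (m + 1) := rfl

/-- `distOp q d i` is `[i]!` times the operator of the distance-`i` graph. -/
def distOp (q : R) (d : ℕ) : ℕ → Module.End R (ℕ → R)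
  | 0 => 1
  | 1 => adjOp q d
  | i + 2 => adjOp q d * distOp q d (i + 1) - stayCoeff q (i + 1) • distOp q d (i + 1) -
      (awayCoeff q d i * qNat q (i + 1)) • distOp q d i

lemma adjOp_single_zero (q : R) (d : ℕ) :
    adjOp q d (Pi.single 0 1) = Pi.single 1 1 := by
  funext m
  rcases m with _ | _ | m <;> simp [adjOp_apply, stayCoeff]

/-- The three-term recurrence that `distOp` solves. Scaling the `i`-th distance operator by `[i]!`
removes the division by `[i + 2]`, so the recursion makes sense over `ℤ[X]`. -/
lemma adjOp_single_succ (q : R) (d i : ℕ) :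
    adjOp q d (Pi.single (i + 1) 1) = qNat q (i + 2) • Pi.single (i + 2) 1 +
      stayCoeff q (i + 1) • Pi.single (i + 1) 1 + awayCoeff q d i • Pi.single i 1 := by
  funext m
  simp only [adjOp_apply, Pi.single_apply, Pi.add_apply, Pi.smul_apply, smul_eq_mul]
  by_cases h1 : m = i + 2
  · subst h1; simp
  by_cases h2 : m = i + 1
  · subst h2; simp
  by_cases h3 : m = i
  · subst h3; simp
  have : m - 1 ≠ i + 1 := by omega
  simp [h1, h2, h3, this]

lemma distOp_single_zero (q : R) (d i : ℕ) :
    distOp q d i (Pi.single 0 1) = qFact q i • Pi.single i 1 := by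
  induction i using Nat.strong_induction_on with
  | _ i ih =>
    rcases i with _ | _ | i
    · simp [distOp]
    · simp [distOp, adjOp_single_zero, qFact_succ]
    · have h1 := ih (i + 1) (by omega)
      have h0 := ih i (by omega)
      simp only [distOp, LinearMap.sub_apply, Module.End.mul_apply, LinearMap.smul_apply, h1, h0,
        map_smul, adjOp_single_succ, smul_add, smul_smul, qFact_succ]
      module

lemma distOp_commute (q : R) (d i : ℕ) : Commute (distOp q d i) (adjOp q d) := by
  induction i using Nat.strong_induction_on with
  | _ i ih =>
    rcases i with _ | _ | i
    · exact Commute.one_left _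
    · exact Commute.refl _
    · have h1 := ih (i + 1) (by omega)
      have h0 := ih i (by omega)
      exact (((Commute.refl _).mul_left h1).sub_left (h1.smul_left _)).sub_left (h0.smul_left _)

lemma map_adjOp {S : Type*} [CommRing S] (φ : R →+* S) (q : R) (d : ℕ) (g : ℕ → R) (m : ℕ) :
    φ (adjOp q d g m) = adjOp (φ q) d (fun n => φ (g n)) m := by
  simp [adjOp_apply, stayCoeff, awayCoeff, map_qNat]

lemma map_distOp {S : Type*} [CommRing S] (φ : R →+* S) (q : R) (d i : ℕ) (g : ℕ → R) (m : ℕ) :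
    φ (distOp q d i g m) = distOp (φ q) d i (fun n => φ (g n)) m := by
  induction i using Nat.strong_induction_on generalizing m with
  | _ i ih =>
    rcases i with _ | _ | i
    · simp [distOp]
    · simp [distOp, map_adjOp]
    · have h1 := fun m => ih (i + 1) (by omega) m
      have h0 := ih i (by omega) m
      simp only [distOp, LinearMap.sub_apply, Module.End.mul_apply, LinearMap.smul_apply,
        Pi.sub_apply, Pi.smul_apply, smul_eq_mul, map_sub, map_mul, map_adjOp, h1, h0]
      simp [stayCoeff, awayCoeff, map_qNat]

/-- One computation over `ℤ[X]` specializes both to the counts, at `X = q`, and to the generic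
algebra, at `X = v ^ 2`. -/
lemma map_distOp_single {S : Type*} [CommRing S] (φ : R →+* S) (q : R) (d i l m : ℕ) :
    φ (distOp q d i (Pi.single l 1) m) = distOp (φ q) d i (Pi.single l 1) m := by
  have h : (fun n => φ ((Pi.single l 1 : ℕ → R) n)) = Pi.single l 1 := by
    funext k
    simp only [Pi.single_apply]
    split_ifs <;> simp
  rw [map_distOp, h]

/-- The functions vanishing at the distances `0, …, d`. -/
def vanish (R : Type*) [CommRing R] (d : ℕ) : Submodule R (ℕ → R) where
  carrier := {g | ∀ m ≤ d, g m = 0}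
  add_mem' hg hh m hm := by simp [hg m hm, hh m hm]
  zero_mem' := by simp
  smul_mem' c g hg m hm := by simp [hg m hm]

/-- `awayCoeff q d d = 0`, so values beyond distance `d` never reach the range `0, …, d`. This is
why functions on all of `ℕ`, taken modulo `vanish`, can stand for functions on `{0, …, d}`. -/
lemma adjOp_mem_vanish {q : R} {d : ℕ} {g : ℕ → R} (hg : g ∈ vanish R d) :
    adjOp q d g ∈ vanish R d := by
  intro m hm
  rw [adjOp_apply, hg m hm, hg (m - 1) (by omega)]
  rcases hm.lt_or_eq with h | rfl
  · simp [hg (m + 1) h]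
  · simp [awayCoeff]

lemma distOp_mem_vanish {q : R} {d : ℕ} (i : ℕ) {g : ℕ → R} (hg : g ∈ vanish R d) :
    distOp q d i g ∈ vanish R d := by
  induction i using Nat.strong_induction_on with
  | _ i ih =>
    rcases i with _ | _ | i
    · simpa [distOp] using hg
    · exact adjOp_mem_vanish hg
    · exact sub_mem (sub_mem (adjOp_mem_vanish (ih _ (by omega)))
        (Submodule.smul_mem _ _ (ih _ (by omega)))) (Submodule.smul_mem _ _ (ih _ (by omega)))

lemma aeval_mem_of_forall_mem {M : Type*} [AddCommGroup M] [Module R M] {T : Module.End R M}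
    {N : Submodule R M} (hT : ∀ g ∈ N, T g ∈ N) (p : R[X]) {g : M} (hg : g ∈ N) :
    aeval T p g ∈ N := by
  induction p using Polynomial.induction_on' with
  | add p r hp hr => simpa using add_mem hp hr
  | monomial n a =>
    rw [aeval_monomial, Module.End.mul_apply, Module.algebraMap_end_apply]
    refine N.smul_mem _ ?_
    induction n with
    | zero => simpa using hg
    | succ n ih => rw [pow_succ', Module.End.mul_apply]; exact hT _ ih

end Operator

/-! ### Triangular form and eigenvalues of the adjacency operator -/

section Eigen

variable {K : Type*} [Field K]

/-- The functions `m ↦ q ^ (-m * k)` for `k < n`, up to functions vanishing on `0, …, d`. -/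
def powFlag (q : K) (d n : ℕ) : Submodule K (ℕ → K) :=
  Submodule.span K ((fun k m => (q⁻¹ ^ m) ^ k) '' Set.Iio n) ⊔ vanish K d

/-- The eigenvalue `q [d - k] - [k]` of the dual polar graph. -/
def eigenVal (q : K) (d k : ℕ) : K := q * qNat q (d - k) - qNat q k

/-- With `x = q^(-m)`, the right side is a multiple of `x^(k-1)`, and it is zero for `k = 0`. Thus
adjacency is triangular on powers of `x`, with diagonal entries `eigenVal q d k`. -/
lemma adjOp_pow {q : K} (hq : q ≠ 0) (hq1 : q ≠ 1) {d k : ℕ} (hk : k ≤ d) :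
    adjOp q d (fun m => (q⁻¹ ^ m) ^ k) - eigenVal q d k • (fun m => (q⁻¹ ^ m) ^ k) =
      (qNat q k * (1 + q * q⁻¹ ^ k)) • fun m => q ^ m * (q⁻¹ ^ m) ^ k := by
  obtain ⟨e, rfl⟩ := Nat.exists_eq_add_of_le hk
  have hx : q ^ k * q⁻¹ ^ k = 1 := by rw [← mul_pow, mul_inv_cancel₀ hq, one_pow]
  have hk' := sub_one_mul_qNat q k
  have he := sub_one_mul_qNat q e
  have hd := sub_one_mul_qNat q (k + e)
  funext m
  -- After multiplication by `q - 1` every `q`-integer can be replaced through `(q - 1)[n] = q^n -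
  -- 1`.
  apply mul_left_cancel₀ (sub_ne_zero.2 hq1)
  simp only [Pi.sub_apply, Pi.smul_apply, smul_eq_mul, adjOp_apply, eigenVal, stayCoeff, awayCoeff,
    Nat.add_sub_cancel_left]
  rw [pow_add] at hd
  -- At `m = 0` the index `m - 1` truncates to `0`, but its coefficient `[0]` vanishes.
  rcases m with _ | m
  · simp only [pow_zero, one_pow, zero_add, pow_one, qNat_zero]
    linear_combination q * q⁻¹ ^ k * hd - q * he - q * q⁻¹ ^ k * hk' + (q * q ^ e - q) * hx
  · have hm := sub_one_mul_qNat q (m + 1)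
    have h1 : (q⁻¹ ^ (m + 1)) ^ k = (q⁻¹ ^ m) ^ k * q⁻¹ ^ k := by rw [pow_succ, mul_pow]
    have h2 : (q⁻¹ ^ (m + 1 + 1)) ^ k = (q⁻¹ ^ m) ^ k * q⁻¹ ^ k * q⁻¹ ^ k := by
      rw [pow_succ, mul_pow, h1]
    simp only [Nat.add_sub_cancel, h1, h2]
    generalize (q⁻¹ ^ m) ^ k = w at *
    generalize q⁻¹ ^ k = z at *
    generalize q ^ (m + 1) = y at *
    linear_combination (w + (q - 1) * w * z - q * w * z ^ 2) * hm + q * w * z ^ 2 * hd -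
      q * w * z * he + (w * z - (1 + q * z) * y * w * z) * hk' +
      w * (q * q ^ e * z + 1 - y - q * y * z) * hx

/-- Triangularity: subtracting the `k`-th diagonal entry kills the leading power and maps the lower
powers into their own span. -/
lemma sub_eigenVal_mem_powFlag {q : K} (hq : q ≠ 0) (hq1 : q ≠ 1) {d k : ℕ} (hk : k ≤ d)
    {g : ℕ → K} (hg : g ∈ powFlag q d (k + 1)) :
    adjOp q d g - eigenVal q d k • g ∈ powFlag q d k := by
  let L : Module.End K (ℕ → K) := adjOp q d - eigenVal q d k • 1
  have hL (g) : L g = adjOp q d g - eigenVal q d k • g := by simp [L]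
  rw [← hL]
  suffices powFlag q d (k + 1) ≤ (powFlag q d k).comap L from this hg
  have hle (n) : vanish K d ≤ powFlag q d n := le_sup_right
  have hpow {l n : ℕ} (h : l < n) : (fun m => (q⁻¹ ^ m) ^ l : ℕ → K) ∈ powFlag q d n :=
    (le_sup_left : _ ≤ powFlag q d n) (Submodule.subset_span ⟨l, h, rfl⟩)
  refine sup_le (Submodule.span_le.2 ?_) ?_
  · rintro _ ⟨l, hl, rfl⟩
    have hl : l ≤ k := Nat.lt_succ_iff.1 hl
    have key : adjOp q d (fun m => (q⁻¹ ^ m) ^ l) - eigenVal q d l • (fun m => (q⁻¹ ^ m) ^ l) ∈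
        powFlag q d l := by
      rw [adjOp_pow hq hq1 (hl.trans hk)]
      rcases l with _ | l
      · simp
      · refine Submodule.smul_mem _ _ ?_
        convert hpow (Nat.lt_succ_self l) using 2 with m
        rw [pow_succ (q⁻¹ ^ _) l, mul_left_comm, ← mul_pow, mul_inv_cancel₀ hq, one_pow, mul_one]
    have mono : powFlag q d l ≤ powFlag q d k :=
      sup_le_sup_right (Submodule.span_mono (Set.image_mono (Set.Iio_subset_Iio hl))) _
    change L (fun m => (q⁻¹ ^ m) ^ l) ∈ powFlag q d k
    rw [hL]
    rcases hl.eq_or_lt with rfl | hlt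
    · exact key
    · have := add_mem (mono key)
        (Submodule.smul_mem _ (eigenVal q d l - eigenVal q d k) (hpow hlt))
      convert this using 1
      module
  · intro g hg
    change L g ∈ powFlag q d k
    rw [hL]
    exact hle _ (sub_mem (adjOp_mem_vanish hg) (Submodule.smul_mem _ _ hg))

/-- Lagrange interpolation: the polynomial `f` of degree at most `d` is `1` at the node `1` and `0`
at the nodes `q^(-1), …, q^(-d)`. The node `1` differs from the others because `q` is not a root of
unity. -/
lemma single_zero_mem_powFlag {q : K} (hq1 : ∀ m, 0 < m → q ^ m ≠ 1) (d : ℕ) :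
    (Pi.single 0 1 : ℕ → K) ∈ powFlag q d (d + 1) := by
  have hle : vanish K d ≤ powFlag q d (d + 1) := le_sup_right
  let f : K[X] := ∏ m ∈ Finset.Icc 1 d, (C (1 - q⁻¹ ^ m)⁻¹ * (X - C (q⁻¹ ^ m)))
  have hinv (m : ℕ) (hm : 0 < m) : 1 - q⁻¹ ^ m ≠ 0 := by
    intro h
    apply hq1 m hm
    rw [sub_eq_zero, inv_pow, eq_comm, inv_eq_one] at h
    exact h
  have hdeg : f.natDegree < d + 1 := by
    refine Nat.lt_succ_iff.2 ((natDegree_prod_le _ _).trans ?_)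
    refine (Finset.sum_le_card_nsmul _ _ 1 fun m _ => ?_).trans (by simp)
    exact (natDegree_C_mul_le _ _).trans (natDegree_X_sub_C_le _)
  have hmem : (fun m => f.eval (q⁻¹ ^ m)) ∈ powFlag q d (d + 1) := by
    have : (fun m => f.eval (q⁻¹ ^ m)) =
        ∑ k ∈ Finset.range (d + 1), f.coeff k • fun m : ℕ => (q⁻¹ ^ m) ^ k := by
      funext m
      simp [eval_eq_sum_range' hdeg]
    rw [this]
    exact sum_mem fun k hk => Submodule.smul_mem _ _ ((le_sup_left : _ ≤ powFlag q d (d + 1))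
      (Submodule.subset_span ⟨k, Finset.mem_range.1 hk, rfl⟩))
  have hv : (Pi.single 0 1 : ℕ → K) - (fun m => f.eval (q⁻¹ ^ m)) ∈ vanish K d := by
    intro m hm
    rcases Nat.eq_zero_or_pos m with rfl | hpos
    · rw [Pi.sub_apply, Pi.single_eq_same, sub_eq_zero, eval_prod, eq_comm]
      refine Finset.prod_eq_one fun m hm => ?_
      have := hinv m (Finset.mem_Icc.1 hm).1
      simp only [eval_mul, eval_C, eval_sub, eval_X, pow_zero]
      exact inv_mul_cancel₀ this
    · rw [Pi.sub_apply, Pi.single_eq_of_ne hpos.ne', zero_sub, neg_eq_zero, eval_prod]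
      exact Finset.prod_eq_zero (Finset.mem_Icc.2 ⟨hpos, hm⟩) (by simp)
  simpa using add_mem (hle hv) hmem

lemma aeval_prod_mem_vanish {q : K} (hq : q ≠ 0) (hq1 : ∀ m, 0 < m → q ^ m ≠ 1) (d : ℕ)
    (α β : K) :
    aeval (α • adjOp q d + β • 1)
      (∏ k ∈ Finset.range (d + 1), (X - C (α * eigenVal q d k + β))) (Pi.single 0 1) ∈
      vanish K d := by
  have hq1' : q ≠ 1 := by simpa using hq1 1 one_pos
  suffices ∀ n ≤ d + 1, ∀ g ∈ powFlag q d n, aeval (α • adjOp q d + β • 1)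
      (∏ k ∈ Finset.range n, (X - C (α * eigenVal q d k + β))) g ∈ vanish K d from
    this _ le_rfl _ (single_zero_mem_powFlag hq1 d)
  intro n
  induction n with
  | zero =>
    intro _ g hg
    simpa [powFlag] using hg
  | succ n ih =>
    intro hn g hg
    -- The factor with the largest index acts first and lowers the flag by one step; after all
    -- factors only `powFlag q d 0 = vanish K d` is left.
    rw [Finset.prod_range_succ, map_mul, Module.End.mul_apply]
    refine ih (by omega) _ ?_
    have := Submodule.smul_mem _ α (sub_eigenVal_mem_powFlag hq hq1' (by omega) hg)
    convert this using 1
    simp only [map_sub, aeval_X, aeval_C, LinearMap.sub_apply, LinearMap.add_apply,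
      LinearMap.smul_apply, Module.End.one_apply, Module.algebraMap_end_apply]
    module

end Eigen

/-! ### Maximal isotropic subspaces -/

section Isotropic

variable {F E : Type*} [Field F] [AddCommGroup E] [Module F E] [FiniteDimensional F E]

open Module

/-- `V` is an isotropic subspace of dimension `d`. -/
def IsMaxIso (B : LinearMap.BilinForm F E) (d : ℕ) (V : Submodule F E) : Prop :=
  V ≤ B.orthogonal V ∧ finrank F V = d

lemma finrank_inf_ker_add_one {U : Submodule F E} {l : E →ₗ[F] F} (h : ∃ u ∈ U, l u ≠ 0) :
    finrank F ↥(U ⊓ LinearMap.ker l) + 1 = finrank F U := by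
  obtain ⟨u, hu, hlu⟩ := h
  have hne : l.domRestrict U ≠ 0 := fun h0 => hlu (LinearMap.congr_fun h0 ⟨u, hu⟩)
  have := Module.Dual.finrank_ker_add_one_of_ne_zero hne
  have h2 : U ⊓ LinearMap.ker l = (LinearMap.ker (l.domRestrict U)).map U.subtype := by
    ext x
    simp [and_comm]
  rw [h2, Submodule.finrank_map_subtype_eq]
  exact this

omit [FiniteDimensional F E] in
lemma isotropic_sup_span {B : LinearMap.BilinForm F E} (hs : B.IsSymm) {U : Submodule F E}
    (hU : U ≤ B.orthogonal U) {w : E} (hw : w ∈ B.orthogonal U) (hww : B w w = 0) :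
    U ⊔ Submodule.span F {w} ≤ B.orthogonal (U ⊔ Submodule.span F {w}) := by
  intro x hx y hy
  obtain ⟨u, hu, s, hs', rfl⟩ := Submodule.mem_sup.1 hx
  obtain ⟨c, rfl⟩ := Submodule.mem_span_singleton.1 hs'
  obtain ⟨u', hu', s', hs'', rfl⟩ := Submodule.mem_sup.1 hy
  obtain ⟨c', rfl⟩ := Submodule.mem_span_singleton.1 hs''
  have h1 : B u' u = 0 := hU hu u' hu'
  have h2 : B u' w = 0 := hw u' hu'
  have h3 : B w u = 0 := by rw [hs.eq]; exact hw u hu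
  simp [h1, h2, h3, hww]

variable {B : LinearMap.BilinForm F E} (hB : B.Nondegenerate) (hs : B.IsSymm) {d : ℕ}
  (hdim : finrank F E = 2 * d + 1)

include hB hdim

lemma finrank_le_of_isotropic {U : Submodule F E} (hU : U ≤ B.orthogonal U) :
    finrank F U ≤ d := by
  have h1 := LinearMap.BilinForm.finrank_orthogonal hB U
  have h2 := Submodule.finrank_mono hU
  have h3 := Submodule.finrank_le U
  omega

include hs

/-- Otherwise `V + ⟨w⟩` would be isotropic of dimension `d + 1`. -/
lemma IsMaxIso.mem_of_mem_orthogonal {V : Submodule F E} (hV : IsMaxIso B d V) {w : E}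
    (hw : w ∈ B.orthogonal V) (hww : B w w = 0) : w ∈ V := by
  by_contra h
  have := finrank_le_of_isotropic hB hdim (isotropic_sup_span hs hV.1 hw hww)
  rw [Submodule.finrank_sup_span_singleton h, hV.2] at this
  omega

lemma IsMaxIso.exists_ne_zero {V : Submodule F E} (hV : IsMaxIso B d V) {w : E}
    (hww : B w w = 0) (hw : w ∉ V) : ∃ u ∈ V, B w u ≠ 0 := by
  by_contra! h
  exact hw (hV.mem_of_mem_orthogonal hB hs hdim
    (fun u hu => by rw [hs.eq]; exact h u hu) hww)

/-- The only maximal isotropic subspace through the isotropic vector `w` that meets `V` in a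
hyperplane of `V`. -/
def neighbour (B : LinearMap.BilinForm F E) (V : Submodule F E) (w : E) : Submodule F E :=
  (V ⊓ LinearMap.ker (B w)) ⊔ Submodule.span F {w}

omit hB hs hdim [FiniteDimensional F E] in
lemma mem_neighbour_self (V : Submodule F E) (w : E) : w ∈ neighbour B V w :=
  (le_sup_right : _ ≤ neighbour B V w) (Submodule.mem_span_singleton_self w)

lemma IsMaxIso.isMaxIso_neighbour {V : Submodule F E} (hV : IsMaxIso B d V) {w : E}
    (hww : B w w = 0) (hw : w ∉ V) : IsMaxIso B d (neighbour B V w) := by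
  refine ⟨isotropic_sup_span hs ?_ ?_ hww, ?_⟩
  · exact fun x hx y hy => hV.1 hx.1 y hy.1
  · intro y hy
    rw [hs.eq]
    exact hy.2
  · rw [neighbour, Submodule.finrank_sup_span_singleton
      (fun h => hw (Submodule.mem_inf.1 h).1),
      finrank_inf_ker_add_one (hV.exists_ne_zero hB hs hdim hww hw), hV.2]

omit hB hs hdim in
lemma IsMaxIso.finrank_inf_lt {V W : Submodule F E} (hW : IsMaxIso B d W)
    (h : ¬ W ≤ V) : finrank F ↥(V ⊓ W) < d := by
  rw [← hW.2]
  exact Submodule.finrank_lt_finrank_of_lt (inf_le_right.lt_of_not_ge fun h' =>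
    h (h'.trans inf_le_left))

lemma IsMaxIso.finrank_inf_neighbour {V : Submodule F E} (hV : IsMaxIso B d V) {w : E}
    (hww : B w w = 0) (hw : w ∉ V) : finrank F ↥(V ⊓ neighbour B V w) + 1 = d := by
  have h1 := finrank_inf_ker_add_one (hV.exists_ne_zero hB hs hdim hww hw)
  have h2 : V ⊓ LinearMap.ker (B w) ≤ V ⊓ neighbour B V w :=
    le_inf inf_le_left le_sup_left
  have h3 := Submodule.finrank_mono h2
  have h4 := (hV.isMaxIso_neighbour hB hs hdim hww hw).finrank_inf_lt
    (fun h => hw (h (mem_neighbour_self V w)))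
  rw [hV.2] at h1
  omega

/-- Since `W` is isotropic and contains `w`, the intersection `V ∩ W` lies in `V ∩ w^⊥`, and both
have dimension `d - 1`. So `w` determines `W`, which makes the double counts of pairs `(W, w)` below
work. -/
lemma IsMaxIso.eq_neighbour {V W : Submodule F E} (hV : IsMaxIso B d V) (hW : IsMaxIso B d W)
    (hadj : finrank F ↥(V ⊓ W) + 1 = d) {w : E} (hwW : w ∈ W) (hw : w ∉ V) :
    W = neighbour B V w := by
  have hww : B w w = 0 := hW.1 hwW w hwW
  have h1 := finrank_inf_ker_add_one (hV.exists_ne_zero hB hs hdim hww hw)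
  have h2 : V ⊓ W ≤ V ⊓ LinearMap.ker (B w) :=
    le_inf inf_le_left fun x hx => hW.1 hx.2 w hwW
  have h3 : V ⊓ W = V ⊓ LinearMap.ker (B w) :=
    Submodule.eq_of_le_of_finrank_eq h2 (by rw [hV.2] at h1; omega)
  symm
  refine Submodule.eq_of_le_of_finrank_eq (sup_le (h3 ▸ inf_le_right) ?_) ?_
  · simpa using hwW
  · rw [(hV.isMaxIso_neighbour hB hs hdim hww hw).2, hW.2]

/-- If `W` meets `V` in a hyperplane and does not contain `V ⊓ V'`, then `W ⊓ V'` is contained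
in `V`. -/
lemma IsMaxIso.inf_le_of_not_le {V V' W : Submodule F E} (hV : IsMaxIso B d V)
    (hV' : IsMaxIso B d V') (hW : IsMaxIso B d W) (hadj : finrank F ↥(V ⊓ W) + 1 = d)
    (h : ¬ V ⊓ V' ≤ W) : W ⊓ V' ≤ V := by
  rintro w ⟨hwW, hwV'⟩
  by_contra hw
  -- A vector `w` of `W ∩ V'` outside `V` gives `W = (V ∩ w^⊥) + ⟨w⟩`, which contains `V ∩ V'`
  -- because `V'` is isotropic.
  rw [hV.eq_neighbour hB hs hdim hW hadj hwW hw] at h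
  exact h fun x hx => (le_sup_left : _ ≤ neighbour B V w)
    ⟨hx.1, hV'.1 hx.2 w hwV'⟩

omit hB hs hdim in
-- The hyperplane `V ∩ W` of `V` does not contain `V ∩ V'`, so it cuts `V ∩ V'` in codimension one,
-- and this section is `W ∩ V'`.
lemma IsMaxIso.finrank_of_not_le {V V' W : Submodule F E} (hV : IsMaxIso B d V)
    (hadj : finrank F ↥(V ⊓ W) + 1 = d) (h : ¬ V ⊓ V' ≤ W) (h' : W ⊓ V' ≤ V) :
    finrank F ↥(W ⊓ V') + 1 = finrank F ↥(V ⊓ V') := by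
  have h1 : W ⊓ V' = (V ⊓ V') ⊓ (V ⊓ W) :=
    le_antisymm (le_inf (le_inf h' inf_le_right) (le_inf h' inf_le_left))
      (le_inf (inf_le_right.trans inf_le_right) (inf_le_left.trans inf_le_right))
  have h2 : V ⊓ W ⊔ V ⊓ V' = V := by
    refine Submodule.eq_of_le_of_finrank_le (sup_le inf_le_left inf_le_left) ?_
    have : V ⊓ W < V ⊓ W ⊔ V ⊓ V' := le_sup_left.lt_of_not_ge fun hle =>
      h ((le_sup_right.trans hle).trans inf_le_right)
    have := Submodule.finrank_lt_finrank_of_lt this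
    rw [hV.2]
    omega
  have h3 := Submodule.finrank_sup_add_finrank_inf_eq (V ⊓ W) (V ⊓ V')
  rw [h2, hV.2, inf_comm, ← h1] at h3
  omega

omit hB hs hdim in
-- The preceding lemma with `V` and `W` exchanged.
lemma IsMaxIso.finrank_of_le_of_not_le {V V' W : Submodule F E} (hW : IsMaxIso B d W)
    (hadj : finrank F ↥(V ⊓ W) + 1 = d) (h : V ⊓ V' ≤ W) (h' : ¬ W ⊓ V' ≤ V) :
    finrank F ↥(W ⊓ V') = finrank F ↥(V ⊓ V') + 1 := by
  have h1 := hW.finrank_of_not_le (V' := V') (by rwa [inf_comm]) h' h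
  exact h1.symm

omit hB hs hdim [FiniteDimensional F E] in
lemma inf_eq_of_le_of_le {V V' W : Submodule F E} (h : V ⊓ V' ≤ W) (h' : W ⊓ V' ≤ V) :
    W ⊓ V' = V ⊓ V' :=
  le_antisymm (le_inf h' inf_le_right) (le_inf h inf_le_right)

end Isotropic

/-! ### Counting neighbours of a maximal isotropic subspace -/

section Counting

open Module

open scoped Classical

variable {F E : Type*} [Field F] [AddCommGroup E] [Module F E] [FiniteDimensional F E]
  [Fintype F] [Fintype E]

omit [FiniteDimensional F E] in
lemma card_filter_mem (S : Submodule F E) :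
    (Finset.univ.filter (· ∈ S)).card = Fintype.card F ^ finrank F S := by
  rw [← Module.card_eq_pow_finrank (K := F) (V := S), Fintype.card_subtype]

omit [FiniteDimensional F E] in
lemma card_filter_mem_notMem (S U : Submodule F E) :
    (Finset.univ.filter fun w => w ∈ S ∧ w ∉ U).card + Fintype.card F ^ finrank F ↥(U ⊓ S) =
      Fintype.card F ^ finrank F S := by
  rw [← card_filter_mem, ← card_filter_mem, ← Finset.card_filter_add_card_filter_not
    (s := Finset.univ.filter (· ∈ S)) (· ∈ U), Finset.filter_filter, Finset.filter_filter, add_comm]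
  congr 3
  ext w
  simp [and_comm]

lemma card_filter_level {U : Submodule F E} {l : E →ₗ[F] F} (h : ∃ u ∈ U, l u ≠ 0) (c : F) :
    (Finset.univ.filter fun a => a ∈ U ∧ l a = c).card * Fintype.card F =
      Fintype.card F ^ finrank F U := by
  obtain ⟨u, hu, hlu⟩ := id h
  have hc : l ((c / l u) • u) = c := by simp [hlu]
  have hmem : (c / l u) • u ∈ U := U.smul_mem _ hu
  rw [← finrank_inf_ker_add_one h, pow_succ, ← card_filter_mem]
  congr 1
  refine Finset.card_nbij' (fun a => a - (c / l u) • u) (fun a => a + (c / l u) • u) ?_ ?_ ?_ ?_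
  · intro a ha
    simp only [Finset.coe_filter, Finset.mem_univ, true_and, Set.mem_ofPred_eq,
      Submodule.mem_inf, LinearMap.mem_ker] at ha ⊢
    exact ⟨sub_mem ha.1 hmem, by rw [map_sub, hc, ha.2, sub_self]⟩
  · intro a ha
    simp only [Finset.coe_filter, Finset.mem_univ, true_and, Set.mem_ofPred_eq,
      Submodule.mem_inf, LinearMap.mem_ker] at ha ⊢
    exact ⟨add_mem ha.1 hmem, by rw [map_add, hc, ha.2, zero_add]⟩
  · intro a _; simp
  · intro a _; simp

variable {B : LinearMap.BilinForm F E} (hB : B.Nondegenerate) (hs : B.IsSymm) {d : ℕ}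
  (hdim : finrank F E = 2 * d + 1)

include hB hs hdim

/-- The number of isotropic vectors orthogonal to `S` and not contained in `V`. -/
lemma IsMaxIso.card_isotropic (h2 : (2 : F) ≠ 0) {V S : Submodule F E} (hV : IsMaxIso B d V)
    (hSV : S ≤ V) :
    (Finset.univ.filter fun w => w ∈ B.orthogonal S ∧ B w w = 0 ∧ w ∉ V).card +
      Fintype.card F ^ d = Fintype.card F ^ (2 * d - finrank F S) := by
  set q := Fintype.card F with hq
  have hq0 : 0 < q := Fintype.card_pos
  set N := (Finset.univ.filter fun w => w ∈ B.orthogonal S ∧ B w w = 0 ∧ w ∉ V).card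
  let Y := Finset.univ.filter fun x => x ∈ B.orthogonal S ∧ x ∉ B.orthogonal V
  have horth : B.orthogonal V ≤ B.orthogonal S := LinearMap.BilinForm.orthogonal_le hSV
  have hs_le : finrank F S ≤ d := hV.2 ▸ Submodule.finrank_mono hSV
  have hY : Y.card + q ^ (d + 1) = q ^ (2 * d + 1 - finrank F S) := by
    have := card_filter_mem_notMem (B.orthogonal S) (B.orthogonal V)
    rw [inf_eq_left.2 horth, LinearMap.BilinForm.finrank_orthogonal hB,
      LinearMap.BilinForm.finrank_orthogonal hB, hdim, hV.2,
      show 2 * d + 1 - d = d + 1 by omega] at this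
    exact this
  -- Count pairs `(x, a)` with `x ∈ S^⊥ \ V^⊥`, `a ∈ V` and `x + a` isotropic. For fixed `a`, the
  -- sum `x + a` runs over the vectors to be counted. For fixed `x`, the condition `B(x,x) + 2B(x,a)
  -- = 0` is an affine equation on `V`, nontrivial as `2 ≠ 0` and `x ∉ V^⊥`.
  have key := Finset.sum_card_bipartiteAbove_eq_sum_card_bipartiteBelow
    (fun x a => B (x + a) (x + a) = 0) (s := Y) (t := Finset.univ.filter (· ∈ V))
  have hright : ∀ a ∈ Finset.univ.filter (· ∈ V),
      (Finset.bipartiteBelow (fun x a => B (x + a) (x + a) = 0) Y a).card = N := by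
    intro a ha
    have ha : a ∈ V := by simpa using ha
    refine Finset.card_nbij' (fun x => x + a) (fun x => x - a) ?_ ?_ ?_ ?_
    · intro x hx
      simp only [Finset.coe_filter, Finset.bipartiteBelow, Y, Finset.mem_filter, Finset.mem_univ,
        true_and, Set.mem_ofPred_eq] at hx ⊢
      refine ⟨add_mem hx.1.1 (horth (hV.1 ha)), hx.2, fun h => hx.1.2 (hV.1 ?_)⟩
      simpa using sub_mem h ha
    · intro x hx
      simp only [Finset.coe_filter, Finset.bipartiteBelow, Y, Finset.mem_filter, Finset.mem_univ,
        true_and, Set.mem_ofPred_eq] at hx ⊢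
      refine ⟨⟨sub_mem hx.1 (horth (hV.1 ha)), fun h => hx.2.2 ?_⟩, by simpa using hx.2.1⟩
      refine hV.mem_of_mem_orthogonal hB hs hdim ?_ hx.2.1
      simpa using add_mem h (hV.1 ha)
    · intro x _; simp
    · intro x _; simp
  have hleft : ∀ x ∈ Y, (Finset.bipartiteAbove (fun x a => B (x + a) (x + a) = 0)
      (Finset.univ.filter (· ∈ V)) x).card * q = q ^ d := by
    intro x hx
    have hx : x ∉ B.orthogonal V := (Finset.mem_filter.1 hx).2.2
    have hne : ∃ u ∈ V, B x u ≠ 0 := by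
      by_contra! h
      exact hx fun u hu => by rw [hs.eq]; exact h u hu
    rw [← hV.2, ← card_filter_level hne (-(B x x) / 2)]
    congr 2
    ext a
    simp only [Finset.bipartiteAbove, Finset.mem_filter, Finset.mem_univ, true_and]
    refine and_congr_right fun ha => ?_
    have haa : B a a = 0 := hV.1 ha a ha
    simp only [map_add, LinearMap.add_apply, haa, hs.eq a x]
    rw [eq_div_iff h2]
    constructor <;> intro h <;> linear_combination h
  have h1 : Y.card * q ^ d = N * q ^ d * q := by
    rw [Finset.sum_congr rfl hright, Finset.sum_const, card_filter_mem, hV.2, smul_eq_mul] at key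
    rw [mul_comm N, ← key, Finset.sum_mul, Finset.sum_congr rfl hleft, Finset.sum_const,
      smul_eq_mul]
  have h3 : Y.card = N * q := Nat.eq_of_mul_eq_mul_right (pow_pos hq0 d) (by linarith)
  apply Nat.eq_of_mul_eq_mul_right hq0
  rw [add_mul, ← h3, ← pow_succ, ← pow_succ, hY]
  congr 1
  omega

variable [Fintype (Submodule F E)]

/-- The neighbours of `V` in the dual polar graph. -/
def neighbours (B : LinearMap.BilinForm F E) (d : ℕ) (V : Submodule F E) :
    Finset (Submodule F E) :=
  Finset.univ.filter fun W => IsMaxIso B d W ∧ finrank F ↥(V ⊓ W) + 1 = d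

omit hB hs hdim in
lemma card_int_pred_pos : (0 : ℤ) < Fintype.card F - 1 := by
  have : 1 < Fintype.card F := Fintype.one_lt_card
  omega

/-- The number of neighbours of `V` containing a given subspace of `V`. -/
lemma IsMaxIso.card_neighbours (h2 : (2 : F) ≠ 0) {V S : Submodule F E} (hV : IsMaxIso B d V)
    (hSV : S ≤ V) :
    (((neighbours B d V).filter (S ≤ ·)).card : ℤ) =
      Fintype.card F * qNat (Fintype.card F : ℤ) (d - finrank F S) := by
  have hs_le : finrank F S ≤ d := hV.2 ▸ Submodule.finrank_mono hSV
  -- In rank `0` there are no neighbours; otherwise `e = d - 1` is the dimension of `V ∩ W`.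
  rcases d with _ | e
  · simp [neighbours]
  have hcount := hV.card_isotropic hB hs hdim h2 hSV
  -- Count pairs `(W, w)` with `w ∈ W \ V`. Each `W` contributes `(q - 1) q^e` vectors, and each
  -- isotropic `w ∈ S^⊥ \ V` lies in exactly one `W`.
  have key := Finset.sum_card_bipartiteAbove_eq_sum_card_bipartiteBelow
    (fun (W : Submodule F E) w => w ∈ W ∧ w ∉ V)
    (s := (neighbours B (e + 1) V).filter (S ≤ ·))
    (t := Finset.univ.filter fun w => w ∈ B.orthogonal S ∧ B w w = 0 ∧ w ∉ V)
  have hleft : ∀ W ∈ (neighbours B (e + 1) V).filter (S ≤ ·),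
      ((Finset.bipartiteAbove (fun (W : Submodule F E) w => w ∈ W ∧ w ∉ V)
        (Finset.univ.filter fun w => w ∈ B.orthogonal S ∧ B w w = 0 ∧ w ∉ V) W).card : ℤ) =
      (Fintype.card F - 1) * Fintype.card F ^ e := by
    intro W hW
    simp only [neighbours, Finset.mem_filter, Finset.mem_univ, true_and] at hW
    obtain ⟨⟨hW, hadj⟩, hSW⟩ := hW
    have := card_filter_mem_notMem W V
    rw [hW.2, show finrank F ↥(V ⊓ W) = e by omega] at this
    have h3 : Finset.bipartiteAbove (fun (W : Submodule F E) w => w ∈ W ∧ w ∉ V)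
        (Finset.univ.filter fun w => w ∈ B.orthogonal S ∧ B w w = 0 ∧ w ∉ V) W =
        Finset.univ.filter fun w => w ∈ W ∧ w ∉ V := by
      ext w
      simp only [Finset.bipartiteAbove, Finset.mem_filter, Finset.mem_univ, true_and]
      refine ⟨fun h => h.2, fun h => ⟨⟨fun u hu => hW.1 h.1 u (hSW hu), hW.1 h.1 w h.1, h.2⟩, h⟩⟩
    rw [h3, sub_mul, one_mul, ← pow_succ', eq_sub_iff_add_eq]
    exact_mod_cast this
  have hright : ∀ w ∈ Finset.univ.filter fun w => w ∈ B.orthogonal S ∧ B w w = 0 ∧ w ∉ V,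
      (Finset.bipartiteBelow (fun (W : Submodule F E) w => w ∈ W ∧ w ∉ V)
        ((neighbours B (e + 1) V).filter (S ≤ ·)) w).card = 1 := by
    intro w hw
    simp only [Finset.mem_filter, Finset.mem_univ, true_and] at hw
    obtain ⟨hwS, hww, hwV⟩ := hw
    rw [Finset.card_eq_one]
    refine ⟨neighbour B V w, ?_⟩
    ext W
    simp only [Finset.bipartiteBelow, neighbours, Finset.mem_filter, Finset.mem_univ, true_and,
      Finset.mem_singleton]
    constructor
    · rintro ⟨⟨⟨hW, hadj⟩, -⟩, hwW, -⟩
      exact hV.eq_neighbour hB hs hdim hW hadj hwW hwV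
    · rintro rfl
      refine ⟨⟨⟨hV.isMaxIso_neighbour hB hs hdim hww hwV,
        hV.finrank_inf_neighbour hB hs hdim hww hwV⟩, ?_⟩,
        mem_neighbour_self V w, hwV⟩
      refine le_trans (le_inf hSV fun u hu => ?_) le_sup_left
      rw [LinearMap.mem_ker, hs.eq]
      exact hwS u hu
  rw [Finset.sum_congr rfl hright, Finset.sum_const, smul_eq_mul, mul_one] at key
  have key' := congrArg (Nat.cast : ℕ → ℤ) key
  rw [Nat.cast_sum, Finset.sum_congr rfl hleft, Finset.sum_const, nsmul_eq_mul] at key'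
  have hcount' := congrArg (Nat.cast : ℕ → ℤ) hcount
  push_cast at hcount'
  rw [show 2 * (e + 1) - finrank F S = (e + 1 - finrank F S) + (e + 1) by omega, pow_add,
    ← eq_sub_iff_add_eq] at hcount'
  rw [hcount'] at key'
  have hpos := card_int_pred_pos (F := F)
  have hq := sub_one_mul_qNat (Fintype.card F : ℤ) (e + 1 - finrank F S)
  have hne : ((Fintype.card F : ℤ) - 1) * Fintype.card F ^ e ≠ 0 :=
    mul_ne_zero hpos.ne' (pow_ne_zero _ (by positivity))
  apply mul_right_cancel₀ hne
  rw [key']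
  linear_combination (-(Fintype.card F : ℤ) ^ (e + 1)) * hq

/-- The number of neighbours of `V` that are closer to `V'`. -/
lemma IsMaxIso.card_closer {V V' : Submodule F E} (hV : IsMaxIso B d V)
    (hV' : IsMaxIso B d V') :
    (((neighbours B d V).filter fun W => V ⊓ V' ≤ W ∧ ¬ W ⊓ V' ≤ V).card : ℤ) =
      qNat (Fintype.card F : ℤ) (d - finrank F ↥(V ⊓ V')) := by
  set n := finrank F ↥(V ⊓ V') with hn
  have hle : n ≤ d := hV.2 ▸ Submodule.finrank_mono inf_le_left
  -- Count pairs `(W, w)` with `w ∈ (W ∩ V') \ V`. For a closer `W`, the space `W ∩ V'` has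
  -- dimension `n + 1` and meets `V` in `V ∩ V'`; each `w ∈ V' \ V` lies in exactly one such `W`.
  have key := Finset.sum_card_bipartiteAbove_eq_sum_card_bipartiteBelow
    (fun (W : Submodule F E) w => w ∈ W)
    (s := (neighbours B d V).filter fun W => V ⊓ V' ≤ W ∧ ¬ W ⊓ V' ≤ V)
    (t := Finset.univ.filter fun w => w ∈ V' ∧ w ∉ V)
  have hleft : ∀ W ∈ (neighbours B d V).filter fun W => V ⊓ V' ≤ W ∧ ¬ W ⊓ V' ≤ V,
      ((Finset.bipartiteAbove (fun (W : Submodule F E) w => w ∈ W)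
        (Finset.univ.filter fun w => w ∈ V' ∧ w ∉ V) W).card : ℤ) =
      (Fintype.card F - 1) * Fintype.card F ^ n := by
    intro W hW
    simp only [neighbours, Finset.mem_filter, Finset.mem_univ, true_and] at hW
    obtain ⟨⟨hW, hadj⟩, h, h'⟩ := hW
    have h3 : Finset.bipartiteAbove (fun (W : Submodule F E) w => w ∈ W)
        (Finset.univ.filter fun w => w ∈ V' ∧ w ∉ V) W =
        Finset.univ.filter fun w => w ∈ W ⊓ V' ∧ w ∉ V := by
      ext w
      simp only [Finset.bipartiteAbove, Finset.mem_filter, Finset.mem_univ, true_and,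
        Submodule.mem_inf]
      tauto
    have := card_filter_mem_notMem (W ⊓ V') V
    rw [hW.finrank_of_le_of_not_le hadj h h', show V ⊓ (W ⊓ V') = V ⊓ V' from
      le_antisymm (le_inf inf_le_left (inf_le_right.trans inf_le_right))
        (le_inf inf_le_left (le_inf h inf_le_right)), ← hn] at this
    rw [h3, sub_mul, one_mul, ← pow_succ', eq_sub_iff_add_eq]
    exact_mod_cast this
  have hright : ∀ w ∈ Finset.univ.filter fun w => w ∈ V' ∧ w ∉ V,
      (Finset.bipartiteBelow (fun (W : Submodule F E) w => w ∈ W)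
        ((neighbours B d V).filter fun W => V ⊓ V' ≤ W ∧ ¬ W ⊓ V' ≤ V) w).card = 1 := by
    intro w hw
    simp only [Finset.mem_filter, Finset.mem_univ, true_and] at hw
    obtain ⟨hwV', hwV⟩ := hw
    have hww : B w w = 0 := hV'.1 hwV' w hwV'
    rw [Finset.card_eq_one]
    refine ⟨neighbour B V w, ?_⟩
    ext W
    simp only [Finset.bipartiteBelow, neighbours, Finset.mem_filter, Finset.mem_univ, true_and,
      Finset.mem_singleton]
    constructor
    · rintro ⟨⟨⟨hW, hadj⟩, -⟩, hwW⟩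
      exact hV.eq_neighbour hB hs hdim hW hadj hwW hwV
    · rintro rfl
      refine ⟨⟨⟨hV.isMaxIso_neighbour hB hs hdim hww hwV,
        hV.finrank_inf_neighbour hB hs hdim hww hwV⟩,
        le_trans (le_inf inf_le_left fun u hu => hV'.1 hu.2 w hwV') le_sup_left,
        fun h => hwV (h ⟨mem_neighbour_self V w, hwV'⟩)⟩, mem_neighbour_self V w⟩
  rw [Finset.sum_congr rfl hright, Finset.sum_const, smul_eq_mul, mul_one] at key
  have key' := congrArg (Nat.cast : ℕ → ℤ) key
  rw [Nat.cast_sum, Finset.sum_congr rfl hleft, Finset.sum_const, nsmul_eq_mul] at key'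
  have hcount := congrArg (Nat.cast : ℕ → ℤ) (card_filter_mem_notMem V' V)
  push_cast at hcount
  rw [hV'.2, ← hn, ← eq_sub_iff_add_eq] at hcount
  rw [hcount] at key'
  have hpos := card_int_pred_pos (F := F)
  have hq := sub_one_mul_qNat (Fintype.card F : ℤ) (d - n)
  have hpow : (Fintype.card F : ℤ) ^ d = Fintype.card F ^ (d - n) * Fintype.card F ^ n := by
    rw [← pow_add, Nat.sub_add_cancel hle]
  have hne : ((Fintype.card F : ℤ) - 1) * Fintype.card F ^ n ≠ 0 :=
    mul_ne_zero hpos.ne' (pow_ne_zero _ (by positivity))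
  apply mul_right_cancel₀ hne
  rw [key']
  linear_combination (-(Fintype.card F : ℤ) ^ n) * hq + hpow

/-- Distance in the dual polar graph. -/
def dist (d : ℕ) (V W : Submodule F E) : ℕ := d - finrank F ↥(V ⊓ W)

/-- The sum of a function of the distance to `V'` over the neighbours of `V`. -/
lemma IsMaxIso.sum_neighbours (h2 : (2 : F) ≠ 0) {V V' : Submodule F E} (hV : IsMaxIso B d V)
    (hV' : IsMaxIso B d V') (g : ℕ → ℤ) :
    ∑ W ∈ neighbours B d V, g (dist d W V') =
      adjOp (Fintype.card F : ℤ) d g (dist d V V') := by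
  have hle : finrank F ↥(V ⊓ V') ≤ d := hV.2 ▸ Submodule.finrank_mono inf_le_left
  have hall := hV.card_neighbours hB hs hdim h2 (bot_le : ⊥ ≤ V)
  have hsub := hV.card_neighbours hB hs hdim h2 (inf_le_left : V ⊓ V' ≤ V)
  have hclose := hV.card_closer hB hs hdim hV'
  simp only [bot_le, Finset.filter_true, finrank_bot, Nat.sub_zero] at hall
  rw [← Finset.filter_filter] at hclose
  have hs1 := Finset.card_filter_add_card_filter_not (s := neighbours B d V) (V ⊓ V' ≤ ·)
  have hs2 := Finset.card_filter_add_card_filter_not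
    (s := (neighbours B d V).filter (V ⊓ V' ≤ ·)) (fun W => ¬ W ⊓ V' ≤ V)
  -- Three classes: `W` is further from `V'` when it does not contain `V ∩ V'`; otherwise it is
  -- closer or equally far according to whether `W ∩ V'` leaves `V`. The last two counts come from
  -- `hclose` and differences with `hsub` and `hall`.
  rw [← Finset.sum_filter_add_sum_filter_not (neighbours B d V) (V ⊓ V' ≤ ·),
    ← Finset.sum_filter_add_sum_filter_not ((neighbours B d V).filter (V ⊓ V' ≤ ·))
      (fun W => ¬ W ⊓ V' ≤ V)]
  set m := dist d V V' with hm
  have e1 : ∀ W ∈ ((neighbours B d V).filter (V ⊓ V' ≤ ·)).filter (fun W => ¬ W ⊓ V' ≤ V),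
      g (dist d W V') = g (m - 1) := by
    intro W hW
    simp only [neighbours, Finset.mem_filter, Finset.mem_univ, true_and] at hW
    obtain ⟨⟨⟨hW, hadj⟩, h⟩, h'⟩ := hW
    have := hW.finrank_of_le_of_not_le hadj h h'
    congr 1
    simp only [dist, hm]
    omega
  have e2 : ∀ W ∈ ((neighbours B d V).filter (V ⊓ V' ≤ ·)).filter (fun W => ¬ ¬ W ⊓ V' ≤ V),
      g (dist d W V') = g m := by
    intro W hW
    simp only [neighbours, Finset.mem_filter, Finset.mem_univ, true_and, not_not] at hW
    obtain ⟨⟨⟨hW, hadj⟩, h⟩, h'⟩ := hW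
    rw [hm, dist, dist, inf_eq_of_le_of_le h h']
  have e3 : ∀ W ∈ (neighbours B d V).filter (fun W => ¬ V ⊓ V' ≤ W),
      g (dist d W V') = g (m + 1) := by
    intro W hW
    simp only [neighbours, Finset.mem_filter, Finset.mem_univ, true_and] at hW
    obtain ⟨⟨hW, hadj⟩, h⟩ := hW
    have := hV.finrank_of_not_le hadj h (hV.inf_le_of_not_le hB hs hdim hV' hW hadj h)
    congr 1
    simp only [dist, hm]
    omega
  rw [Finset.sum_congr rfl e1, Finset.sum_congr rfl e2, Finset.sum_congr rfl e3]
  simp only [Finset.sum_const, nsmul_eq_mul, adjOp_apply, stayCoeff, awayCoeff]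
  rw [hclose]
  change _ = qNat _ (d - _) * _ + _ * qNat _ (d - _) * _ + (_ - _ * qNat _ (d - _)) * _
  zify at hs1 hs2
  rw [hall, hsub] at hs1
  rw [hclose, hsub] at hs2
  linear_combination g (m + 1) * hs1 + g m * hs2

end Counting

/-! ### Distance regularity -/

section Distance

open Module

open scoped Classical

variable {F E : Type*} [Field F] [AddCommGroup E] [Module F E] [FiniteDimensional F E]
  [Fintype F] [Fintype E] [Fintype (Submodule F E)]

/-- The finite set of maximal isotropic subspaces. -/
def maxIsos (B : LinearMap.BilinForm F E) (d : ℕ) : Finset (Submodule F E) :=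
  Finset.univ.filter (IsMaxIso B d)

omit [FiniteDimensional F E] [Fintype F] [Fintype E] in
lemma mem_maxIsos {B : LinearMap.BilinForm F E} {d : ℕ} {V : Submodule F E} :
    V ∈ maxIsos B d ↔ IsMaxIso B d V := by
  simp [maxIsos]

omit [Fintype F] [Fintype E] [Fintype (Submodule F E)] in
lemma IsMaxIso.dist_eq_zero_iff {B : LinearMap.BilinForm F E} {d : ℕ} {V W : Submodule F E}
    (hV : IsMaxIso B d V) (hW : IsMaxIso B d W) : dist d V W = 0 ↔ V = W := by
  constructor
  · intro h
    have h1 : d ≤ finrank F ↥(V ⊓ W) := Nat.sub_eq_zero_iff_le.1 h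
    have h2 : V ⊓ W = V := Submodule.eq_of_le_of_finrank_le inf_le_left (by rw [hV.2]; exact h1)
    have h3 : V ⊓ W = W := Submodule.eq_of_le_of_finrank_le inf_le_right (by rw [hW.2]; exact h1)
    rw [← h2, h3]
  · rintro rfl
    rw [dist, inf_idem, hV.2, Nat.sub_self]

variable {B : LinearMap.BilinForm F E} (hB : B.Nondegenerate) (hs : B.IsSymm) {d : ℕ}
  (hdim : finrank F E = 2 * d + 1)

include hB hs hdim

/-- The convolution of two functions of the distance. -/
lemma sum_distOp (h2 : (2 : F) ≠ 0) (g : ℕ → ℤ) (i : ℕ) {V V' : Submodule F E}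
    (hV : IsMaxIso B d V) (hV' : IsMaxIso B d V') :
    ∑ W ∈ maxIsos B d, distOp (Fintype.card F : ℤ) d i (Pi.single 0 1) (dist d V W) *
      g (dist d W V') = distOp (Fintype.card F : ℤ) d i g (dist d V V') := by
  -- Applying adjacency to the kernel is summing the kernel over the neighbours of `V`. This carries
  -- the recursion of `distOp` over to the convolutions.
  have step (h : ℕ → ℤ) {V : Submodule F E} (hV : IsMaxIso B d V) :
      ∑ W ∈ maxIsos B d, adjOp (Fintype.card F : ℤ) d h (dist d V W) * g (dist d W V') =
        ∑ U ∈ neighbours B d V, ∑ W ∈ maxIsos B d, h (dist d U W) * g (dist d W V') := by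
    rw [Finset.sum_comm]
    refine Finset.sum_congr rfl fun W hW => ?_
    rw [← Finset.sum_mul, hV.sum_neighbours hB hs hdim h2 (mem_maxIsos.1 hW)]
  have hnb {V U : Submodule F E} (hU : U ∈ neighbours B d V) : IsMaxIso B d U :=
    (Finset.mem_filter.1 hU).2.1
  have base {V : Submodule F E} (hV : IsMaxIso B d V) :
      ∑ W ∈ maxIsos B d, (Pi.single 0 1 : ℕ → ℤ) (dist d V W) * g (dist d W V') =
        g (dist d V V') := by
    rw [Finset.sum_eq_single_of_mem V (mem_maxIsos.2 hV)]
    · rw [(hV.dist_eq_zero_iff hV).2 rfl]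
      simp
    · intro W hW hne
      rw [Pi.single_eq_of_ne, zero_mul]
      exact fun h => hne ((hV.dist_eq_zero_iff (mem_maxIsos.1 hW)).1 h).symm
  induction i using Nat.strong_induction_on generalizing V with
  | _ i ih =>
    rcases i with _ | _ | i
    · simpa only [distOp, Module.End.one_apply] using base hV
    · simp only [distOp]
      rw [step _ hV, Finset.sum_congr rfl fun U hU => base (hnb hU),
        hV.sum_neighbours hB hs hdim h2 hV']
    · simp only [distOp, LinearMap.sub_apply, Module.End.mul_apply, LinearMap.smul_apply,
        Pi.sub_apply, Pi.smul_apply, smul_eq_mul, sub_mul, Finset.sum_sub_distrib]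
      rw [step _ hV, Finset.sum_congr rfl fun U hU => ih (i + 1) (by omega) (hnb hU),
        hV.sum_neighbours hB hs hdim h2 hV']
      congr 1
      · congr 1
        rw [← ih (i + 1) (by omega) hV, Finset.mul_sum]
        simp only [mul_assoc]
      · rw [← ih i (by omega) hV, Finset.mul_sum]
        simp only [mul_assoc]

/-- The intersection numbers of the dual polar graph. -/
lemma qFact_mul_card (h2 : (2 : F) ≠ 0) (i l : ℕ) {V V' : Submodule F E}
    (hV : IsMaxIso B d V) (hV' : IsMaxIso B d V') :
    qFact (Fintype.card F : ℤ) i *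
      ((maxIsos B d).filter fun W => dist d V W = i ∧ dist d W V' = l).card =
      distOp (Fintype.card F : ℤ) d i (Pi.single l 1) (dist d V V') := by
  rw [← sum_distOp hB hs hdim h2 _ i hV hV', distOp_single_zero, Finset.card_filter,
    Nat.cast_sum, Finset.mul_sum]
  refine Finset.sum_congr rfl fun W _ => ?_
  simp only [Pi.smul_apply, Pi.single_apply, smul_eq_mul]
  by_cases h1 : dist d V W = i <;> by_cases h2 : dist d W V' = l <;> simp [h1, h2]

/-- The number of hyperplanes of a maximal isotropic subspace. -/
lemma IsMaxIso.card_hyperplanes (h2 : (2 : F) ≠ 0) {V : Submodule F E} (hV : IsMaxIso B d V) :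
    ((Finset.univ.filter fun H : Submodule F E => H ≤ V ∧ finrank F H + 1 = d).card : ℤ) =
      qNat (Fintype.card F : ℤ) d := by
  -- Each hyperplane of `V` lies in `q` neighbours and each neighbour contains exactly one, `V ∩ W`;
  -- there are `q[d]` neighbours.
  have key := Finset.sum_card_bipartiteAbove_eq_sum_card_bipartiteBelow
    (fun H W : Submodule F E => H ≤ W)
    (s := Finset.univ.filter fun H : Submodule F E => H ≤ V ∧ finrank F H + 1 = d)
    (t := neighbours B d V)
  have hleft : ∀ H ∈ Finset.univ.filter fun H : Submodule F E => H ≤ V ∧ finrank F H + 1 = d,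
      ((Finset.bipartiteAbove (fun H W : Submodule F E => H ≤ W) (neighbours B d V) H).card : ℤ) =
        Fintype.card F := by
    intro H hH
    simp only [Finset.mem_filter, Finset.mem_univ, true_and] at hH
    have := hV.card_neighbours hB hs hdim h2 hH.1
    rw [show d - finrank F H = 1 by omega, qNat_one, mul_one] at this
    exact this
  have hright : ∀ W ∈ neighbours B d V,
      (Finset.bipartiteBelow (fun H W : Submodule F E => H ≤ W)
        (Finset.univ.filter fun H : Submodule F E => H ≤ V ∧ finrank F H + 1 = d) W).card = 1 := by
    intro W hW
    simp only [neighbours, Finset.mem_filter, Finset.mem_univ, true_and] at hW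
    rw [Finset.card_eq_one]
    refine ⟨V ⊓ W, ?_⟩
    ext H
    simp only [Finset.bipartiteBelow, Finset.mem_filter, Finset.mem_univ, true_and,
      Finset.mem_singleton]
    constructor
    · rintro ⟨⟨hHV, hH⟩, hHW⟩
      exact Submodule.eq_of_le_of_finrank_eq (le_inf hHV hHW) (by omega)
    · rintro rfl
      exact ⟨⟨inf_le_left, hW.2⟩, inf_le_right⟩
  rw [Finset.sum_congr rfl hright, Finset.sum_const, smul_eq_mul, mul_one] at key
  have hall := hV.card_neighbours hB hs hdim h2 (bot_le : ⊥ ≤ V)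
  simp only [bot_le, Finset.filter_true, finrank_bot, Nat.sub_zero] at hall
  have key' := congrArg (Nat.cast : ℕ → ℤ) key
  rw [Nat.cast_sum, Finset.sum_congr rfl hleft, Finset.sum_const, nsmul_eq_mul, hall,
    mul_comm] at key'
  exact mul_left_cancel₀ (Nat.cast_ne_zero.2 Fintype.card_ne_zero) key'

end Distance

/-! ### Flags and their relative positions -/

section Flags

open Module

variable {F : Type} [Field F] {d : ℕ}

lemma form_apply (x y : Fin (2 * d + 1) → F) : form F d x y = ∑ i, x i * y (Fin.rev i) := by
  rw [form, Matrix.toBilin'_apply]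
  refine Finset.sum_congr rfl fun i _ => ?_
  rw [Finset.sum_eq_single (Fin.rev i)]
  · simp
  · intro l _ hl
    simp [hl]
  · simp

lemma form_isSymm : (form F d).IsSymm := by
  refine ⟨fun x y => ?_⟩
  rw [form_apply, form_apply]
  refine Fintype.sum_equiv Fin.revPerm _ _ fun i => ?_
  simp [mul_comm]

lemma form_nondegenerate : (form F d).Nondegenerate := by
  have h : ∀ x : Fin (2 * d + 1) → F, (∀ y, form F d x y = 0) → x = 0 := by
    intro x hx
    funext i
    have := hx (Pi.single (Fin.rev i) 1)
    rw [form_apply, Finset.sum_eq_single i] at this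
    · simpa using this
    · intro l _ hl
      rw [Pi.single_eq_of_ne (fun h => hl (Fin.rev_injective h)), mul_zero]
    · simp
  exact ⟨h, fun y hy => h y fun x => by rw [form_isSymm.eq]; exact hy x⟩

lemma finrank_space : finrank F (Fin (2 * d + 1) → F) = 2 * d + 1 := by simp

lemma form_isRefl : (form F d).IsRefl := form_isSymm.isRefl

lemma finrank_orth (U : Submodule F (Fin (2 * d + 1) → F)) :
    finrank F ↥((form F d).orthogonal U) + finrank F U = 2 * d + 1 := by
  have h1 := LinearMap.BilinForm.finrank_orthogonal (form_nondegenerate (F := F) (d := d)) U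
  have h2 := Submodule.finrank_le U
  rw [finrank_space] at h1 h2
  omega

lemma orth_orth (U : Submodule F (Fin (2 * d + 1) → F)) :
    (form F d).orthogonal ((form F d).orthogonal U) = U :=
  LinearMap.BilinForm.orthogonal_orthogonal form_nondegenerate form_isRefl U

lemma orth_sup (U W : Submodule F (Fin (2 * d + 1) → F)) :
    (form F d).orthogonal (U ⊔ W) = (form F d).orthogonal U ⊓ (form F d).orthogonal W := by
  refine le_antisymm (le_inf (LinearMap.BilinForm.orthogonal_le le_sup_left)
    (LinearMap.BilinForm.orthogonal_le le_sup_right)) ?_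
  rintro x ⟨hx, hx'⟩ y hy
  obtain ⟨u, hu, w, hw, rfl⟩ := Submodule.mem_sup.1 hy
  rw [map_add, LinearMap.add_apply, hx u hu, hx' w hw, add_zero]

namespace IsoFlag

lemma V_two (V : IsoFlag F d) : V.V 2 = (form F d).orthogonal (V.V 1) := V.orth 2

lemma isotropic (V : IsoFlag F d) : V.V 1 ≤ (form F d).orthogonal (V.V 1) := by
  rw [← V.V_two]
  exact V.mono (by decide)

lemma ext_one {V W : IsoFlag F d} (h : V.V 1 = W.V 1) : V = W := by
  refine IsoFlag.ext (funext fun i => ?_)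
  fin_cases i
  · exact V.bot.trans W.bot.symm
  · exact h
  · exact V.V_two.trans ((congrArg _ h).trans W.V_two.symm)
  · exact V.top.trans W.top.symm

/-- The flag with a given isotropic subspace as its first step. -/
def ofIsotropic (U : Submodule F (Fin (2 * d + 1) → F)) (hU : U ≤ (form F d).orthogonal U) :
    IsoFlag F d where
  V := ![⊥, U, (form F d).orthogonal U, ⊤]
  mono := by
    rw [Fin.monotone_iff_le_succ]
    intro i
    fin_cases i
    · exact bot_le
    · exact hU
    · exact le_top
  bot := rfl
  top := rfl
  orth i := by
    fin_cases i
    · change ⊥ = (form F d).orthogonal ⊤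
      exact (LinearMap.BilinForm.orthogonal_top_eq_bot form_nondegenerate).symm
    · exact (orth_orth U).symm
    · rfl
    · change ⊤ = (form F d).orthogonal ⊥
      simp

@[simp] lemma ofIsotropic_one (U : Submodule F (Fin (2 * d + 1) → F))
    (hU : U ≤ (form F d).orthogonal U) : (ofIsotropic U hU).V 1 = U := rfl

end IsoFlag

/-- The entries of the relative position from the dimensions of intersections. -/
lemma relPos_add (V V' : IsoFlag F d) (i j : Fin 3) :
    relPos V V' i j + finrank F ↥(V.V i.succ ⊓ V'.V j.castSucc) +
      finrank F ↥(V.V i.castSucc ⊓ V'.V j.succ) =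
    finrank F ↥(V.V i.succ ⊓ V'.V j.succ) + finrank F ↥(V.V i.castSucc ⊓ V'.V j.castSucc) := by
  have hV : V.V i.castSucc ≤ V.V i.succ := V.mono (Fin.castSucc_lt_succ).le
  have hV' : V'.V j.castSucc ≤ V'.V j.succ := V'.mono (Fin.castSucc_lt_succ).le
  have h1 := Submodule.finrank_sup_add_finrank_inf_eq (V.V i.castSucc) (V.V i.succ ⊓ V'.V j.succ)
  have h2 := Submodule.finrank_sup_add_finrank_inf_eq (V.V i.castSucc)
    (V.V i.succ ⊓ V'.V j.castSucc)
  rw [← inf_assoc, inf_eq_left.2 hV] at h1 h2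
  -- The natural-number subtraction in `relPos` does not truncate.
  have h3 : finrank F ↥(V.V i.castSucc ⊔ (V.V i.succ ⊓ V'.V j.castSucc)) ≤
      finrank F ↥(V.V i.castSucc ⊔ (V.V i.succ ⊓ V'.V j.succ)) :=
    Submodule.finrank_mono (sup_le_sup_left (inf_le_inf_left _ hV') _)
  change finrank F ↥(V.V i.castSucc ⊔ (V.V i.succ ⊓ V'.V j.succ)) -
    finrank F ↥(V.V i.castSucc ⊔ (V.V i.succ ⊓ V'.V j.castSucc)) + _ + _ = _
  omega

/-- All relations between the entries of the relative position and the dimensions of the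
intersections of the isotropic steps. -/
lemma relPos_entries (V V' : IsoFlag F d) :
    ∃ s t : ℕ, s = finrank F ↥(V.V 1 ⊓ (form F d).orthogonal (V'.V 1)) ∧
      t = finrank F ↥(V'.V 1 ⊓ (form F d).orthogonal (V.V 1)) ∧
      finrank F ↥(V.V 1 ⊓ V'.V 1) ≤ finrank F (V.V 1) ∧
      finrank F ↥(V.V 1 ⊓ V'.V 1) ≤ finrank F (V'.V 1) ∧
      finrank F (V.V 1) ≤ d ∧ finrank F (V'.V 1) ≤ d ∧
      relPos V V' 0 0 = finrank F ↥(V.V 1 ⊓ V'.V 1) ∧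
      relPos V V' 0 1 + finrank F ↥(V.V 1 ⊓ V'.V 1) = s ∧
      relPos V V' 0 2 + s = finrank F (V.V 1) ∧
      relPos V V' 1 0 + finrank F ↥(V.V 1 ⊓ V'.V 1) = t ∧
      relPos V V' 1 1 + s + t + finrank F (V.V 1) + finrank F (V'.V 1) =
        2 * d + 1 + 2 * finrank F ↥(V.V 1 ⊓ V'.V 1) ∧
      relPos V V' 1 2 = relPos V V' 1 0 ∧
      relPos V V' 2 0 + t = finrank F (V'.V 1) ∧
      relPos V V' 2 1 = relPos V V' 0 1 ∧
      relPos V V' 2 2 = relPos V V' 0 0 ∧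
      s + finrank F (V'.V 1) = t + finrank F (V.V 1) := by
  have hV := finrank_le_of_isotropic form_nondegenerate finrank_space V.isotropic
  have hV' := finrank_le_of_isotropic form_nondegenerate finrank_space V'.isotropic
  have oV := finrank_orth (V.V 1)
  have oV' := finrank_orth (V'.V 1)
  have osup := finrank_orth (V.V 1 ⊔ V'.V 1)
  rw [orth_sup] at osup
  have hsup := Submodule.finrank_sup_add_finrank_inf_eq (V.V 1) (V'.V 1)
  -- The orthogonal of `V'_1 + V_1^⊥` is `V_1 ∩ V'_1^⊥`; this yields `s + dim V'_1 = t + dim V_1`.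
  have ost := finrank_orth (V'.V 1 ⊔ (form F d).orthogonal (V.V 1))
  rw [orth_sup, orth_orth, inf_comm] at ost
  have hst := Submodule.finrank_sup_add_finrank_inf_eq (V'.V 1) ((form F d).orthogonal (V.V 1))
  obtain ⟨p, hp⟩ : ∃ p : Fin 3 → Fin 3 → ℕ, ∀ i j, p i j = relPos V V' i j :=
    ⟨fun i j => relPos V V' i j, fun _ _ => rfl⟩
  obtain ⟨D, hD⟩ : ∃ D : Submodule F (Fin (2 * d + 1) → F) → ℕ, ∀ U, D U = finrank F U :=
    ⟨fun U => finrank F U, fun _ => rfl⟩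
  have hbot : D ⊥ = 0 := by rw [hD, finrank_bot]
  have hc : D ((form F d).orthogonal (V.V 1) ⊓ V'.V 1) =
      D (V'.V 1 ⊓ (form F d).orthogonal (V.V 1)) := by rw [inf_comm]
  have htop : D ⊤ = 2 * d + 1 := by rw [hD, finrank_top, finrank_space]
  have add (i j : Fin 3) : p i j + D (V.V i.succ ⊓ V'.V j.castSucc) +
      D (V.V i.castSucc ⊓ V'.V j.succ) =
      D (V.V i.succ ⊓ V'.V j.succ) + D (V.V i.castSucc ⊓ V'.V j.castSucc) := by
    simp only [hp, hD]
    exact relPos_add V V' i j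
  rw [← hp, ← hp, ← hp, ← hp, ← hp, ← hp, ← hp, ← hp, ← hp]
  have h00 := add 0 0
  have h01 := add 0 1
  have h02 := add 0 2
  have h10 := add 1 0
  have h11 := add 1 1
  have h12 := add 1 2
  have h20 := add 2 0
  have h21 := add 2 1
  have h22 := add 2 2
  have hl1 := Submodule.finrank_mono (inf_le_left : V.V 1 ⊓ V'.V 1 ≤ V.V 1)
  have hl2 := Submodule.finrank_mono (inf_le_right : V.V 1 ⊓ V'.V 1 ≤ V'.V 1)
  have e0 : (Fin.castSucc (0 : Fin 3)) = 0 := rfl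
  have e1 : (Fin.castSucc (1 : Fin 3)) = 1 := rfl
  have e2 : (Fin.castSucc (2 : Fin 3)) = 2 := rfl
  have e3 : (Fin.succ (0 : Fin 3)) = 1 := rfl
  have e4 : (Fin.succ (1 : Fin 3)) = 2 := rfl
  have e5 : (Fin.succ (2 : Fin 3)) = 3 := rfl
  simp only [e0, e1, e2, e3, e4, e5, V.bot, V'.bot, V.top, V'.top, V.V_two, V'.V_two, bot_inf_eq,
    inf_bot_eq, top_inf_eq, inf_top_eq, hbot, htop, hc, hD]
    at h00 h01 h02 h10 h11 h12 h20 h21 h22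
  refine ⟨_, _, rfl, rfl, ?_⟩
  refine ⟨?_, ?_, ?_, ?_, ?_, ?_, ?_, ?_, ?_, ?_, ?_, ?_, ?_, ?_⟩ <;> omega

end Flags

/-! ### Every index is the relative position of a pair of coordinate flags -/

section Realization

open Module

variable {F : Type} [Field F] {d : ℕ}

/-- The coordinate subspace of vectors supported on `S`. -/
def coordSubspace (F : Type) [Field F] {n : ℕ} (S : Finset (Fin n)) : Submodule F (Fin n → F) where
  carrier := {x | ∀ i ∉ S, x i = 0}
  add_mem' hx hy i hi := by simp [hx i hi, hy i hi]
  zero_mem' := by simp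
  smul_mem' c x hx i hi := by simp [hx i hi]

lemma mem_coordSubspace {n : ℕ} {S : Finset (Fin n)} {x : Fin n → F} :
    x ∈ coordSubspace F S ↔ ∀ i ∉ S, x i = 0 := Iff.rfl

lemma finrank_coordSubspace {n : ℕ} (S : Finset (Fin n)) :
    finrank F (coordSubspace F S) = S.card := by
  have h : coordSubspace F S =
      ⨅ i ∈ ((S : Set (Fin n))ᶜ), LinearMap.ker (LinearMap.proj i : (Fin n → F) →ₗ[F] F) := by
    ext x
    simp [mem_coordSubspace]
  rw [h, (LinearMap.iInfKerProjEquiv F (fun _ : Fin n => F) (I := (S : Set (Fin n)))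
    disjoint_compl_right (by simp)).finrank_eq]
  simp

lemma coordSubspace_inf {n : ℕ} (S T : Finset (Fin n)) :
    coordSubspace F S ⊓ coordSubspace F T = coordSubspace F (S ∩ T) := by
  ext x
  simp only [Submodule.mem_inf, mem_coordSubspace, Finset.mem_inter]
  constructor
  · rintro ⟨h, h'⟩ i hi
    by_cases hS : i ∈ S
    · exact h' i fun hT => hi ⟨hS, hT⟩
    · exact h i hS
  · exact fun h => ⟨fun i hi => h i fun h' => hi h'.1, fun i hi => h i fun h' => hi h'.2⟩

lemma orthogonal_coordSubspace (S : Finset (Fin (2 * d + 1))) :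
    (form F d).orthogonal (coordSubspace F S) =
      coordSubspace F (Finset.univ.filter fun i => Fin.rev i ∉ S) := by
  ext x
  simp only [mem_coordSubspace, Finset.mem_filter, Finset.mem_univ, true_and, not_not]
  constructor
  · intro hx i hi
    have := hx (Pi.single (Fin.rev i) 1) fun l hl => by
      rw [Pi.single_eq_of_ne]
      rintro rfl
      exact hl hi
    rw [form_apply, Finset.sum_eq_single (Fin.rev i)] at this
    · simpa using this
    · intro l _ hl
      rw [Pi.single_eq_of_ne hl, zero_mul]
    · simp
  · intro hx y hy
    rw [form_apply]
    refine Finset.sum_eq_zero fun i _ => ?_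
    by_cases hi : i ∈ S
    · rw [hx (Fin.rev i) (by simpa using hi), mul_zero]
    · rw [hy i hi, zero_mul]

lemma card_filter_fin_Ico {n lo hi : ℕ} (h : hi ≤ n) :
    (Finset.univ.filter fun i : Fin n => lo ≤ i.val ∧ i.val < hi).card = hi - lo := by
  rw [← Nat.card_Ico, ← Finset.card_map Fin.valEmbedding]
  congr 1
  ext i
  simp only [Finset.mem_map, Finset.mem_filter, Finset.mem_univ, true_and, Fin.valEmbedding_apply,
    Finset.mem_Ico]
  exact ⟨by rintro ⟨i, hi, rfl⟩; exact hi, fun hi => ⟨⟨i, by omega⟩, hi, rfl⟩⟩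

/-- The relations between the entries of an index. -/
lemma Xi.entries (C : Xi d) :
    C.1 1 2 = C.1 1 0 ∧ C.1 2 0 = C.1 0 2 ∧ C.1 2 1 = C.1 0 1 ∧ C.1 2 2 = C.1 0 0 ∧
      2 * (C.1 0 0 + C.1 0 1 + C.1 0 2 + C.1 1 0) + C.1 1 1 = 2 * d + 1 := by
  obtain ⟨C, hsum, hsymm⟩ := C
  have h1 : C 1 2 = C 1 0 := hsymm 1 2
  have h2 : C 2 0 = C 0 2 := hsymm 2 0
  have h3 : C 2 1 = C 0 1 := hsymm 2 1
  have h4 : C 2 2 = C 0 0 := hsymm 2 2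
  simp only [Fin.sum_univ_three] at hsum
  refine ⟨h1, h2, h3, h4, ?_⟩
  change 2 * (C 0 0 + C 0 1 + C 0 2 + C 1 0) + C 1 1 = _
  omega

/-- By rotation symmetry and the fixed total, an index has only four free entries, and four
dimensions determine them. -/
lemma relPos_eq_iff (V V' : IsoFlag F d) (C : Xi d) :
    relPos V V' = C.1 ↔
      finrank F (V.V 1) = C.1 0 0 + C.1 0 1 + C.1 0 2 ∧
      finrank F (V'.V 1) = C.1 0 0 + C.1 1 0 + C.1 0 2 ∧
      finrank F ↥(V.V 1 ⊓ V'.V 1) = C.1 0 0 ∧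
      finrank F ↥(V.V 1 ⊓ (form F d).orthogonal (V'.V 1)) = C.1 0 0 + C.1 0 1 := by
  obtain ⟨c1, c2, c3, c4, c5⟩ := C.entries
  obtain ⟨s, t, hs, ht, h⟩ := relPos_entries V V'
  rw [← hs]
  obtain ⟨C, hC⟩ := C
  dsimp only at *
  constructor
  · rintro rfl
    omega
  · intro h'
    ext i j
    fin_cases i <;> fin_cases j <;>
      simp only [Fin.zero_eta, Fin.mk_one, Fin.reduceFinMk] <;> omega

lemma exists_relPos_eq (F : Type) [Field F] (C : Xi d) :
    ∃ V V' : IsoFlag F d, relPos V V' = C.1 := by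
  obtain ⟨-, -, -, -, c5⟩ := C.entries
  set r := C.1 0 0
  set x := C.1 0 1
  set y := C.1 0 2
  set z := C.1 1 0
  have hd : r + x + y + z ≤ d := by omega
  -- The form pairs the coordinate `i` with `Fin.rev i`. `S` spans `V_1`. For `V'_1`, `T₁` is the
  -- common part, `T₂` is orthogonal to `V_1` but outside it, and `T₃` mirrors `[r, r + y) ⊆ S`, the
  -- part of `S` that pairs nontrivially with `V'_1`.
  let S : Finset (Fin (2 * d + 1)) := Finset.univ.filter fun i => 0 ≤ i.val ∧ i.val < r + x + y
  let T₁ : Finset (Fin (2 * d + 1)) := Finset.univ.filter fun i => 0 ≤ i.val ∧ i.val < r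
  let T₂ : Finset (Fin (2 * d + 1)) :=
    Finset.univ.filter fun i => r + x + y ≤ i.val ∧ i.val < r + x + y + z
  let T₃ : Finset (Fin (2 * d + 1)) :=
    Finset.univ.filter fun i => 2 * d + 1 - (r + y) ≤ i.val ∧ i.val < 2 * d + 1 - r
  let S₂ : Finset (Fin (2 * d + 1)) :=
    Finset.univ.filter fun i => r + y ≤ i.val ∧ i.val < r + x + y
  let T := (T₁ ∪ T₂) ∪ T₃
  have hS : coordSubspace F S ≤ (form F d).orthogonal (coordSubspace F S) := by
    rw [orthogonal_coordSubspace]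
    intro v hv i hi
    refine hv i fun h => hi ?_
    simp only [S, Finset.mem_filter, Finset.mem_univ, true_and, Fin.val_rev] at h ⊢
    omega
  have hT : coordSubspace F T ≤ (form F d).orthogonal (coordSubspace F T) := by
    rw [orthogonal_coordSubspace]
    intro v hv i hi
    refine hv i fun h => hi ?_
    simp only [T, T₁, T₂, T₃, Finset.mem_union, Finset.mem_filter, Finset.mem_univ, true_and,
      Fin.val_rev] at h ⊢
    omega
  refine ⟨IsoFlag.ofIsotropic _ hS, IsoFlag.ofIsotropic _ hT, ?_⟩
  rw [relPos_eq_iff]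
  change finrank F (coordSubspace F S) = _ ∧ finrank F (coordSubspace F T) = _ ∧
    finrank F ↥(coordSubspace F S ⊓ coordSubspace F T) = _ ∧
    finrank F ↥(coordSubspace F S ⊓ (form F d).orthogonal (coordSubspace F T)) = _
  rw [orthogonal_coordSubspace, coordSubspace_inf, coordSubspace_inf, finrank_coordSubspace,
    finrank_coordSubspace, finrank_coordSubspace, finrank_coordSubspace]
  have e1 : S ∩ T = T₁ := by
    ext i
    simp only [S, T, T₁, T₂, T₃, Finset.mem_inter, Finset.mem_union, Finset.mem_filter,
      Finset.mem_univ, true_and]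
    omega
  have e2 : (S ∩ Finset.univ.filter fun i => Fin.rev i ∉ T) = T₁ ∪ S₂ := by
    ext i
    simp only [S, S₂, T, T₁, T₂, T₃, Finset.mem_inter, Finset.mem_union, Finset.mem_filter,
      Finset.mem_univ, true_and, Fin.val_rev]
    omega
  have d1 : Disjoint T₁ T₂ := by
    rw [Finset.disjoint_left]
    intro i
    simp only [T₁, T₂, Finset.mem_filter, Finset.mem_univ, true_and]
    omega
  have d2 : Disjoint (T₁ ∪ T₂) T₃ := by
    rw [Finset.disjoint_left]
    intro i
    simp only [T₁, T₂, T₃, Finset.mem_union, Finset.mem_filter, Finset.mem_univ, true_and]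
    omega
  have d3 : Disjoint T₁ S₂ := by
    rw [Finset.disjoint_left]
    intro i
    simp only [T₁, S₂, Finset.mem_filter, Finset.mem_univ, true_and]
    omega
  have k1 : S.card = _ := card_filter_fin_Ico (by omega)
  have k2 : T₁.card = _ := card_filter_fin_Ico (by omega)
  have k3 : T₂.card = _ := card_filter_fin_Ico (by omega)
  have k4 : T₃.card = _ := card_filter_fin_Ico (by omega)
  have k5 : S₂.card = _ := card_filter_fin_Ico (by omega)
  rw [e1, e2, Finset.card_union_of_disjoint d2, Finset.card_union_of_disjoint d1,
    Finset.card_union_of_disjoint d3, k1, k2, k3, k4, k5]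
  omega

end Realization

/-! ### Structure polynomials -/

section StructurePolynomial

variable {d : ℕ}

lemma infinite_odd_primes : {p : ℕ | p.Prime ∧ 2 < p}.Infinite := by
  refine Set.infinite_of_not_bddAbove fun ⟨b, hb⟩ => ?_
  obtain ⟨p, hp, hpp⟩ := Nat.exists_infinite_primes (b + 3)
  have := hb (show p ∈ {p : ℕ | p.Prime ∧ 2 < p} from ⟨hpp, by omega⟩)
  omega

lemma two_ne_zero_zmod {p : ℕ} (hp : 2 < p) : (2 : ZMod p) ≠ 0 := by
  intro h
  have h' : ((2 : ℕ) : ZMod p) = 0 := by exact_mod_cast h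
  exact absurd (Nat.le_of_dvd two_pos ((ZMod.natCast_eq_zero_iff _ _).1 h')) (by omega)

lemma eq_zero_of_eval_primes {R : Type*} [CommRing R] [IsDomain R] [CharZero R] {p : R[X]}
    (h : ∀ n : ℕ, n.Prime → 2 < n → p.eval (n : R) = 0) : p = 0 := by
  refine p.eq_zero_of_infinite_isRoot ?_
  refine (infinite_odd_primes.image (f := fun n : ℕ => (n : R)) Nat.cast_injective.injOn).mono ?_
  rintro _ ⟨n, hn, rfl⟩
  exact h n hn.1 hn.2

/-- Structure polynomials are unique. -/
lemma IsStructurePolynomial.eq {A B C : Xi d} {p p' : ℚ[X]} (h : IsStructurePolynomial A B C p)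
    (h' : IsStructurePolynomial A B C p') : p = p' := by
  rw [← sub_eq_zero]
  refine eq_zero_of_eval_primes fun n hn hn2 => ?_
  have := Fact.mk hn
  -- The orbit is nonempty over every prime field, so the values at all odd primes are prescribed.
  obtain ⟨V, V'', hV⟩ := exists_relPos_eq (ZMod n) C
  have h1 := h (ZMod n) (two_ne_zero_zmod hn2) V V'' hV
  have h2 := h' (ZMod n) (two_ne_zero_zmod hn2) V V'' hV
  rw [Nat.card_zmod] at h1 h2
  rw [eval_sub, ← h1, ← h2, sub_self]

lemma IsStructurePolynomial.structureConst_eq {A B C : Xi d} {p : ℚ[X]}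
    (h : IsStructurePolynomial A B C p) : structureConst A B C = aeval (v ^ 2) p := by
  have hex : ∃ p : ℚ[X], IsStructurePolynomial A B C p := ⟨p, h⟩
  rw [structureConst, dif_pos hex, hex.choose_spec.eq h]

/-- A structure constant vanishes if there are no flags to count. -/
lemma structureConst_eq_zero {A B C : Xi d}
    (h : ∀ (F : Type) [Field F] (V V' V'' : IsoFlag F d), relPos V V'' = C.1 →
      relPos V V' = A.1 → relPos V' V'' = B.1 → False) : structureConst A B C = 0 := by
  have : IsStructurePolynomial A B C 0 := by
    intro F _ _ _ V V'' hC
    have : IsEmpty {V' : IsoFlag F d // relPos V V' = A.1 ∧ relPos V' V'' = B.1} :=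
      ⟨fun V' => h F V V'.1 V'' hC V'.2.1 V'.2.2⟩
    simp
  rw [this.structureConst_eq, map_zero]

lemma structureConst_eq_one {A B C : Xi d}
    (h : ∀ (F : Type) [Field F] (V V'' : IsoFlag F d), relPos V V'' = C.1 →
      ∃! V' : IsoFlag F d, relPos V V' = A.1 ∧ relPos V' V'' = B.1) :
    structureConst A B C = 1 := by
  have : IsStructurePolynomial A B C 1 := by
    intro F _ _ _ V V'' hC
    obtain ⟨V', hV', huniq⟩ := h F V V'' hC
    have : Unique {V' : IsoFlag F d // relPos V V' = A.1 ∧ relPos V' V'' = B.1} :=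
      ⟨⟨⟨V', hV'⟩⟩, fun W => Subtype.ext (huniq W.1 W.2)⟩
    simp
  rw [this.structureConst_eq, map_one]

/-- A monic integral polynomial divides a second one if it divides the values at all primes. -/
lemma dvd_of_eval_primes {D H : ℤ[X]} (hD : D.Monic)
    (h : ∀ n : ℕ, n.Prime → 2 < n → D.eval (n : ℤ) ∣ H.eval (n : ℤ)) : D ∣ H := by
  rw [← Polynomial.modByMonic_eq_zero_iff_dvd hD]
  set r := H %ₘ D with hr
  have hdeg : r.degree < D.degree := degree_modByMonic_lt _ hD
  have hdvd : ∀ n : ℕ, n.Prime → 2 < n → D.eval (n : ℤ) ∣ r.eval (n : ℤ) := by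
    intro n hn hn2
    have : r = H - D * (H /ₘ D) := eq_sub_of_add_eq (modByMonic_add_div H D)
    rw [this, eval_sub, eval_mul]
    exact dvd_sub (h n hn hn2) (dvd_mul_right _ _)
  have hinj : Function.Injective (Int.castRingHom ℝ) := Int.cast_injective
  -- The quotient `r(n) / D(n)` tends to `0` and is an integer at odd primes where `D(n) ≠ 0`, so
  -- the remainder `r` has infinitely many roots.
  have hlim := Polynomial.div_tendsto_atTop_zero_of_degree_lt (r.map (Int.castRingHom ℝ))
    (D.map (Int.castRingHom ℝ)) (by rwa [degree_map_eq_of_injective hinj,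
      degree_map_eq_of_injective hinj])
  have hev := (hlim.comp tendsto_natCast_atTop_atTop).eventually
    (Metric.ball_mem_nhds (0 : ℝ) one_pos)
  obtain ⟨N, hN⟩ := Filter.eventually_atTop.1 hev
  have hroot : ∀ n ∈ {p : ℕ | p.Prime ∧ 2 < p} \ Set.Iio N, r.IsRoot (n : ℤ) := by
    rintro n ⟨⟨hn, hn2⟩, hnN⟩
    obtain ⟨k, hk⟩ := hdvd n hn hn2
    have hb := hN n (by simpa using hnN)
    simp only [Function.comp_apply, dist_zero_right] at hb
    have cast (p : ℤ[X]) : (p.map (Int.castRingHom ℝ)).eval (n : ℝ) =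
        ((p.eval (n : ℤ) : ℤ) : ℝ) := by
      simp
    rw [cast, cast, hk] at hb
    rw [IsRoot, hk]
    by_cases hD0 : D.eval (n : ℤ) = 0
    · rw [hD0, zero_mul]
    · rw [Int.cast_mul, mul_div_cancel_left₀ _ (Int.cast_ne_zero.2 hD0), Real.norm_eq_abs] at hb
      have : |k| < 1 := by exact_mod_cast hb
      rw [Int.abs_lt_one_iff.1 this, mul_zero]
  refine r.eq_zero_of_infinite_isRoot ?_
  refine ((infinite_odd_primes.sdiff (Set.finite_Iio N)).image
    (f := fun n : ℕ => (n : ℤ)) Nat.cast_injective.injOn).mono ?_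
  rintro _ ⟨n, hn, rfl⟩
  exact hroot n hn

lemma monic_qFact (i : ℕ) : (qFact (X : ℤ[X]) i).Monic :=
  monic_prod_of_monic _ _ fun _ _ => monic_geom_sum_X (Nat.succ_ne_zero _)

end StructurePolynomial

/-! ### Structure constants -/

section StructureConstants

open Module

variable {d : ℕ}

/-- The first row sum, the dimension of `V 1` for a pair `(V, V')` in the orbit. -/
def firstRow (C : Xi d) : ℕ := C.1 0 0 + C.1 0 1 + C.1 0 2

/-- The first column sum, the dimension of `V' 1` for a pair `(V, V')` in the orbit. -/
def firstCol (C : Xi d) : ℕ := C.1 0 0 + C.1 1 0 + C.1 0 2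

/-- The index of the pairs of maximal isotropic subspaces at distance `m`. -/
def cornerIdx (d : ℕ) (m : Fin (d + 1)) : Xi d :=
  ⟨!![d - m, 0, m; 0, 1, 0; m, 0, d - m], by
    have := m.is_le
    refine ⟨?_, ?_⟩
    · simp [Fin.sum_univ_three]; omega
    · intro i j; fin_cases i <;> fin_cases j <;> rfl⟩

lemma Xi.ext_entries {A C : Xi d} (h1 : A.1 0 0 = C.1 0 0) (h2 : A.1 0 1 = C.1 0 1)
    (h3 : A.1 0 2 = C.1 0 2) (h4 : A.1 1 0 = C.1 1 0) : A = C := by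
  obtain ⟨a1, a2, a3, a4, a5⟩ := A.entries
  obtain ⟨c1, c2, c3, c4, c5⟩ := C.entries
  obtain ⟨A, hA⟩ := A
  obtain ⟨C, hC⟩ := C
  refine Subtype.ext ?_
  dsimp only at *
  ext i j
  fin_cases i <;> fin_cases j <;>
    simp only [Fin.zero_eta, Fin.mk_one, Fin.reduceFinMk] <;> omega

lemma cornerIdx_zero (d : ℕ) : cornerIdx d 0 = diagIdx d :=
  Xi.ext_entries rfl rfl rfl rfl

lemma cornerIdx_injective (d : ℕ) : Function.Injective (cornerIdx d) := fun m n h =>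
  Fin.ext (show (cornerIdx d m).1 0 2 = (cornerIdx d n).1 0 2 by rw [h])

/-- The total `2d + 1` leaves no room: `a_{21}` and `a_{12}` vanish, and the distance `a_{13}` is
the only parameter. -/
lemma eq_cornerIdx {C : Xi d} (hr : firstRow C = d) (hc : firstCol C = d) :
    ∃ h : C.1 0 2 < d + 1, C = cornerIdx d ⟨C.1 0 2, h⟩ := by
  obtain ⟨c1, c2, c3, c4, c5⟩ := C.entries
  unfold firstRow at hr
  unfold firstCol at hc
  refine ⟨by omega, Xi.ext_entries ?_ ?_ ?_ ?_⟩
  · change _ = d - C.1 0 2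
    omega
  · change _ = 0
    omega
  · rfl
  · change _ = 0
    omega

lemma firstRow_cornerIdx (m : Fin (d + 1)) : firstRow (cornerIdx d m) = d := by
  have := m.is_le
  change d - m + 0 + m = d
  omega

lemma firstCol_cornerIdx (m : Fin (d + 1)) : firstCol (cornerIdx d m) = d := by
  have := m.is_le
  change d - m + 0 + m = d
  omega

variable {F : Type} [Field F]

lemma finrank_eq_firstRow {V V' : IsoFlag F d} {C : Xi d} (h : relPos V V' = C.1) :
    finrank F (V.V 1) = firstRow C := ((relPos_eq_iff V V' C).1 h).1

lemma finrank_eq_firstCol {V V' : IsoFlag F d} {C : Xi d} (h : relPos V V' = C.1) :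
    finrank F (V'.V 1) = firstCol C := ((relPos_eq_iff V V' C).1 h).2.1

lemma structureConst_eq_zero_of_row {A B C : Xi d} (h : firstRow A ≠ firstRow C) :
    structureConst A B C = 0 :=
  structureConst_eq_zero fun _ _ _ _ _ hC hA _ =>
    h ((finrank_eq_firstRow hA).symm.trans (finrank_eq_firstRow hC))

lemma structureConst_eq_zero_of_col {A B C : Xi d} (h : firstCol B ≠ firstCol C) :
    structureConst A B C = 0 :=
  structureConst_eq_zero fun _ _ _ _ _ hC _ hB =>
    h ((finrank_eq_firstCol hB).symm.trans (finrank_eq_firstCol hC))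

lemma structureConst_eq_zero_of_mid {A B C : Xi d} (h : firstCol A ≠ firstRow B) :
    structureConst A B C = 0 :=
  structureConst_eq_zero fun _ _ _ _ _ _ hA hB =>
    h ((finrank_eq_firstCol hA).symm.trans (finrank_eq_firstRow hB))

lemma relPos_eq_cornerIdx_iff {V V' : IsoFlag F d} {m : Fin (d + 1)} :
    relPos V V' = (cornerIdx d m).1 ↔ IsMaxIso (form F d) d (V.V 1) ∧
      IsMaxIso (form F d) d (V'.V 1) ∧ dist d (V.V 1) (V'.V 1) = m := by
  have hm := m.is_le
  rw [relPos_eq_iff]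
  change _ = d - (m : ℕ) + 0 + m ∧ _ = d - (m : ℕ) + 0 + m ∧ _ = d - (m : ℕ) ∧
    _ = d - (m : ℕ) + 0 ↔ _
  constructor
  · rintro ⟨h1, h2, h3, -⟩
    refine ⟨⟨V.isotropic, by omega⟩, ⟨V'.isotropic, by omega⟩, ?_⟩
    rw [dist]
    omega
  · rintro ⟨hV, hV', h⟩
    -- An isotropic vector orthogonal to the maximal `V'_1` lies in it, so the fourth dimension is
    -- redundant here.
    have hinf : V.V 1 ⊓ (form F d).orthogonal (V'.V 1) = V.V 1 ⊓ V'.V 1 :=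
      le_antisymm (le_inf inf_le_left fun x hx => hV'.mem_of_mem_orthogonal form_nondegenerate
        form_isSymm finrank_space hx.2 (hV.1 hx.1 x hx.1)) (inf_le_inf_left _ hV'.1)
    have hle := Submodule.finrank_mono (inf_le_left : V.V 1 ⊓ V'.V 1 ≤ V.V 1)
    rw [hinf]
    have h1 := hV.2
    have h2 := hV'.2
    rw [dist] at h
    omega

lemma qFact_mul_natCard [Finite F] (h2 : (2 : F) ≠ 0) (i l m : Fin (d + 1)) {V V'' : IsoFlag F d}
    (h : relPos V V'' = (cornerIdx d m).1) :
    qFact (Nat.card F : ℤ) i * Nat.card {V' : IsoFlag F d //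
      relPos V V' = (cornerIdx d i).1 ∧ relPos V' V'' = (cornerIdx d l).1} =
      distOp (Nat.card F : ℤ) d i (Pi.single (l : ℕ) 1) m := by
  classical
  let := Fintype.ofFinite F
  let := Fintype.ofFinite (Submodule F (Fin (2 * d + 1) → F))
  obtain ⟨hV, hV'', hm⟩ := relPos_eq_cornerIdx_iff.1 h
  have key := qFact_mul_card form_nondegenerate form_isSymm finrank_space h2 i l hV hV''
  rw [hm] at key
  rw [Nat.card_eq_fintype_card, ← key]
  congr 2
  rw [← Nat.subtype_card (p := fun W => IsMaxIso (form F d) d W ∧ dist d (V.V 1) W = i ∧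
    dist d W (V''.V 1) = l) _ (by intro W; rw [Finset.mem_filter, mem_maxIsos])]
  refine Nat.card_congr
    { toFun := fun V' => ⟨V'.1.V 1, ?_⟩
      invFun := fun W => ⟨IsoFlag.ofIsotropic W.1 W.2.1.1, ?_⟩
      left_inv := fun V' => Subtype.ext (IsoFlag.ext_one rfl)
      right_inv := fun W => rfl }
  · obtain ⟨-, h1, h3⟩ := relPos_eq_cornerIdx_iff.1 V'.2.1
    exact ⟨h1, h3, (relPos_eq_cornerIdx_iff.1 V'.2.2).2.2⟩
  · rw [relPos_eq_cornerIdx_iff, relPos_eq_cornerIdx_iff]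
    exact ⟨⟨hV, W.2.1, W.2.2.1⟩, W.2.1, hV'', W.2.2.2⟩

lemma eval_distOp (n : ℤ) (d i l m : ℕ) :
    (distOp (X : ℤ[X]) d i (Pi.single l 1) m).eval n = distOp n d i (Pi.single l 1) m := by
  have := map_distOp_single (evalRingHom n) X d i l m
  rwa [coe_evalRingHom, eval_X] at this

lemma eval_qFact (n : ℤ) (i : ℕ) : (qFact (X : ℤ[X]) i).eval n = qFact n i := by
  have := map_qFact (evalRingHom n) X i
  rwa [coe_evalRingHom, eval_X] at this

lemma qNat_pos {n : ℤ} (hn : 0 < n) {i : ℕ} (hi : 0 < i) : 0 < qNat n i :=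
  Finset.sum_pos (fun _ _ => pow_pos hn _) (by simpa using hi.ne')

lemma qFact_pos {n : ℤ} (hn : 0 < n) (i : ℕ) : 0 < qFact n i :=
  Finset.prod_pos fun _ _ => qNat_pos hn (Nat.succ_pos _)

/-- The structure constants of the corner algebra. -/
lemma qFact_mul_structureConst (i l m : Fin (d + 1)) :
    qFact (v ^ 2) i * structureConst (cornerIdx d i) (cornerIdx d l) (cornerIdx d m) =
      distOp (v ^ 2) d i (Pi.single (l : ℕ) 1) m := by
  -- Counting over prime fields gives divisibility at primes, hence in `ℤ[X]`. The quotient `P` then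
  -- computes the counts over every finite field of odd characteristic, as `[i]!` is nonzero at `q`.
  obtain ⟨P, hP⟩ : qFact (X : ℤ[X]) i ∣ distOp (X : ℤ[X]) d i (Pi.single (l : ℕ) 1) m := by
    refine dvd_of_eval_primes (monic_qFact _) fun n hn hn2 => ?_
    have := Fact.mk hn
    obtain ⟨V, V'', hV⟩ := exists_relPos_eq (ZMod n) (cornerIdx d m)
    have key := qFact_mul_natCard (two_ne_zero_zmod hn2) i l m hV
    rw [Nat.card_zmod] at key
    rw [eval_distOp, eval_qFact, ← key]
    exact dvd_mul_right _ _
  have hstruct : IsStructurePolynomial (cornerIdx d i) (cornerIdx d l) (cornerIdx d m)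
      (P.map (Int.castRingHom ℚ)) := by
    intro F _ _ h2 V V'' hV
    have key := qFact_mul_natCard h2 i l m hV
    have hpos : (0 : ℤ) < Nat.card F := by exact_mod_cast Nat.card_pos
    rw [← eval_distOp, hP, eval_mul, eval_qFact] at key
    have key' := mul_left_cancel₀ (qFact_pos hpos i).ne' key
    have : ((P.eval (Nat.card F : ℤ) : ℤ) : ℚ) =
        (P.map (Int.castRingHom ℚ)).eval (Nat.card F : ℚ) := by
      simp
    rw [← this, ← key']
    simp
  let φ : ℤ[X] →+* K := eval₂RingHom (Int.castRingHom K) (v ^ 2)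
  have hφX : φ X = v ^ 2 := by simp [φ]
  have hφP : φ P = aeval (v ^ 2) (P.map (Int.castRingHom ℚ)) := by
    rw [aeval_def, eval₂_map, coe_eval₂RingHom]
    congr 1
    exact RingHom.ext_int _ _
  have h1 := map_distOp_single φ X d i l m
  rw [hP, map_mul, map_qFact, hφX, hφP] at h1
  rw [hstruct.structureConst_eq, h1]

/-! ### Diagonal indices -/

/-- `D` is a diagonal matrix. -/
def IsDiagIdx (D : Xi d) : Prop := ∀ i j, i ≠ j → D.1 i j = 0

lemma relPos_eq_diag_iff {D : Xi d} (hD : IsDiagIdx D) {V V' : IsoFlag F d} :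
    relPos V V' = D.1 ↔ V = V' ∧ finrank F (V.V 1) = D.1 0 0 := by
  have h1 : D.1 0 1 = 0 := hD 0 1 (by decide)
  have h2 : D.1 0 2 = 0 := hD 0 2 (by decide)
  have h3 : D.1 1 0 = 0 := hD 1 0 (by decide)
  rw [relPos_eq_iff, h1, h2, h3]
  constructor
  · rintro ⟨a, b, c, -⟩
    have e1 : V.V 1 ⊓ V'.V 1 = V.V 1 := Submodule.eq_of_le_of_finrank_le inf_le_left (by omega)
    have e2 : V.V 1 ⊓ V'.V 1 = V'.V 1 := Submodule.eq_of_le_of_finrank_le inf_le_right (by omega)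
    exact ⟨IsoFlag.ext_one (e1.symm.trans e2), by omega⟩
  · rintro ⟨rfl, h⟩
    rw [inf_idem, inf_eq_left.2 V.isotropic]
    omega

lemma structureConst_diag_right {A D C : Xi d} (hD : IsDiagIdx D) :
    structureConst A D C = if A = C ∧ firstCol C = D.1 0 0 then 1 else 0 := by
  split_ifs with h
  · obtain ⟨rfl, h⟩ := h
    refine structureConst_eq_one fun F _ V V'' hC => ⟨V'', ⟨hC, ?_⟩, fun W hW => ?_⟩
    · rw [relPos_eq_diag_iff hD, finrank_eq_firstCol hC]
      exact ⟨rfl, h⟩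
    · exact ((relPos_eq_diag_iff hD).1 hW.2).1
  · refine structureConst_eq_zero fun F _ V V' V'' hC hA hB => h ?_
    obtain ⟨rfl, h'⟩ := (relPos_eq_diag_iff hD).1 hB
    exact ⟨Subtype.ext (hA.symm.trans hC), by rw [← finrank_eq_firstCol hC, h']⟩

lemma structureConst_diag_left {A D C : Xi d} (hD : IsDiagIdx D) :
    structureConst D A C = if A = C ∧ firstRow C = D.1 0 0 then 1 else 0 := by
  split_ifs with h
  · obtain ⟨rfl, h⟩ := h
    refine structureConst_eq_one fun F _ V V'' hC => ⟨V, ⟨?_, hC⟩, fun W hW => ?_⟩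
    · rw [relPos_eq_diag_iff hD, finrank_eq_firstRow hC]
      exact ⟨rfl, h⟩
    · exact ((relPos_eq_diag_iff hD).1 hW.1).1.symm
  · refine structureConst_eq_zero fun F _ V V' V'' hC hA hB => h ?_
    obtain ⟨rfl, h'⟩ := (relPos_eq_diag_iff hD).1 hA
    exact ⟨Subtype.ext (hB.symm.trans hC), by rw [← finrank_eq_firstRow hC, h']⟩

lemma isDiagIdx_diagIdx (d : ℕ) : IsDiagIdx (diagIdx d) := by
  intro i j hij
  fin_cases i <;> fin_cases j <;> first | exact absurd rfl hij | rfl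

/-! ### Hyperplanes of maximal isotropic subspaces -/

/-- The index of the pairs with `V 1` maximal and `V' 1` a hyperplane of `V 1`. -/
def upIdx (d : ℕ) : Xi (d + 1) :=
  ⟨!![d, 1, 0; 0, 1, 0; 0, 1, d], by
    refine ⟨?_, ?_⟩
    · simp [Fin.sum_univ_three]; omega
    · intro i j; fin_cases i <;> fin_cases j <;> rfl⟩

/-- The index of the pairs with `V' 1` maximal and `V 1` a hyperplane of `V' 1`. -/
def downIdx (d : ℕ) : Xi (d + 1) :=
  ⟨!![d, 0, 0; 1, 1, 1; 0, 0, d], by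
    refine ⟨?_, ?_⟩
    · simp [Fin.sum_univ_three]; omega
    · intro i j; fin_cases i <;> fin_cases j <;> rfl⟩

lemma relPos_eq_upIdx_iff {V V' : IsoFlag F (d + 1)} :
    relPos V V' = (upIdx d).1 ↔
      finrank F (V.V 1) = d + 1 ∧ V'.V 1 ≤ V.V 1 ∧ finrank F (V'.V 1) + 1 = d + 1 := by
  rw [relPos_eq_iff]
  change _ = d + 1 + 0 ∧ _ = d + 0 + 0 ∧ _ = d ∧ _ = d + 1 ↔ _
  constructor
  · rintro ⟨a, b, c, -⟩
    have e : V.V 1 ⊓ V'.V 1 = V'.V 1 := Submodule.eq_of_le_of_finrank_le inf_le_right (by omega)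
    exact ⟨by omega, inf_eq_right.1 e, by omega⟩
  · rintro ⟨a, h, c⟩
    rw [inf_eq_right.2 h, inf_eq_left.2 (V.isotropic.trans
      (LinearMap.BilinForm.orthogonal_le h))]
    omega

lemma relPos_eq_downIdx_iff {V V' : IsoFlag F (d + 1)} :
    relPos V V' = (downIdx d).1 ↔
      finrank F (V'.V 1) = d + 1 ∧ V.V 1 ≤ V'.V 1 ∧ finrank F (V.V 1) + 1 = d + 1 := by
  rw [relPos_eq_iff]
  change _ = d + 0 + 0 ∧ _ = d + 1 + 0 ∧ _ = d ∧ _ = d + 0 ↔ _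
  constructor
  · rintro ⟨a, b, c, -⟩
    have e : V.V 1 ⊓ V'.V 1 = V.V 1 := Submodule.eq_of_le_of_finrank_le inf_le_left (by omega)
    exact ⟨by omega, inf_eq_left.1 e, by omega⟩
  · rintro ⟨a, h, c⟩
    rw [inf_eq_left.2 h, inf_eq_left.2 (h.trans V'.isotropic)]
    omega

lemma qNat_aeval (n : ℕ) : aeval (v ^ 2) (qNat (X : ℚ[X]) n) = qNat (v ^ 2) n := by
  simp [qNat]

lemma structureConst_up_down_zero (d : ℕ) :
    structureConst (upIdx d) (downIdx d) (cornerIdx (d + 1) 0) = qNat (v ^ 2) (d + 1) := by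
  have h : IsStructurePolynomial (upIdx d) (downIdx d) (cornerIdx (d + 1) 0) (qNat X (d + 1)) := by
    intro F _ _ h2 V V'' hVV
    classical
    let := Fintype.ofFinite F
    let := Fintype.ofFinite (Submodule F (Fin (2 * (d + 1) + 1) → F))
    obtain ⟨hV, hV'', hm⟩ := relPos_eq_cornerIdx_iff.1 hVV
    obtain rfl : V = V'' := IsoFlag.ext_one ((hV.dist_eq_zero_iff hV'').1 hm)
    have key := hV.card_hyperplanes form_nondegenerate form_isSymm finrank_space h2
    have hcard : Nat.card {V' : IsoFlag F (d + 1) //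
        relPos V V' = (upIdx d).1 ∧ relPos V' V = (downIdx d).1} =
        (Finset.univ.filter fun H : Submodule F (Fin (2 * (d + 1) + 1) → F) =>
          H ≤ V.V 1 ∧ finrank F H + 1 = d + 1).card := by
      rw [← Nat.subtype_card (p := fun H : Submodule F (Fin (2 * (d + 1) + 1) → F) =>
          H ≤ V.V 1 ∧ finrank F H + 1 = d + 1) _ (by simp)]
      refine Nat.card_congr
        { toFun := fun V' => ⟨V'.1.V 1, (relPos_eq_upIdx_iff.1 V'.2.1).2⟩
          invFun := fun W => ⟨IsoFlag.ofIsotropic W.1 (W.2.1.trans (V.isotropic.trans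
            (LinearMap.BilinForm.orthogonal_le W.2.1))), relPos_eq_upIdx_iff.2 ⟨hV.2, W.2⟩,
            relPos_eq_downIdx_iff.2 ⟨hV.2, W.2⟩⟩
          left_inv := fun V' => Subtype.ext (IsoFlag.ext_one rfl)
          right_inv := fun W => rfl }
    have key' := congrArg (Int.cast : ℤ → ℚ) key
    rw [hcard, Nat.card_eq_fintype_card]
    simpa [qNat, eval_finsetSum] using key'
  rw [h.structureConst_eq, qNat_aeval]

/-- The intersection of two adjacent maximal isotropic subspaces is their only common hyperplane. -/
lemma structureConst_up_down_one (d : ℕ) :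
    structureConst (upIdx d) (downIdx d) (cornerIdx (d + 1) 1) = 1 := by
  refine structureConst_eq_one fun F _ V V'' hV => ?_
  obtain ⟨hV, hV'', hm⟩ := relPos_eq_cornerIdx_iff.1 hV
  have hm : d + 1 - finrank F ↥(V.V 1 ⊓ V''.V 1) = 1 := hm
  have hinf : V.V 1 ⊓ V''.V 1 ≤ (form F (d + 1)).orthogonal (V.V 1 ⊓ V''.V 1) :=
    inf_le_left.trans (V.isotropic.trans (LinearMap.BilinForm.orthogonal_le inf_le_left))
  refine ⟨IsoFlag.ofIsotropic _ hinf, ⟨?_, ?_⟩, ?_⟩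
  · rw [relPos_eq_upIdx_iff]
    exact ⟨hV.2, inf_le_left, show finrank F ↥(V.V 1 ⊓ V''.V 1) + 1 = d + 1 by omega⟩
  · rw [relPos_eq_downIdx_iff]
    exact ⟨hV''.2, inf_le_right, show finrank F ↥(V.V 1 ⊓ V''.V 1) + 1 = d + 1 by omega⟩
  · rintro W ⟨h1, h2⟩
    rw [relPos_eq_upIdx_iff] at h1
    rw [relPos_eq_downIdx_iff] at h2
    exact IsoFlag.ext_one (Submodule.eq_of_le_of_finrank_le (le_inf h1.2.1 h2.2.1)
      (show finrank F ↥(V.V 1 ⊓ V''.V 1) ≤ _ by omega))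

lemma structureConst_up_down_of_two_le {m : Fin (d + 2)} (h : 2 ≤ (m : ℕ)) :
    structureConst (upIdx d) (downIdx d) (cornerIdx (d + 1) m) = 0 := by
  refine structureConst_eq_zero fun F _ V V' V'' hV h1 h2 => ?_
  obtain ⟨hV, hV'', hm⟩ := relPos_eq_cornerIdx_iff.1 hV
  rw [dist] at hm
  rw [relPos_eq_upIdx_iff] at h1
  rw [relPos_eq_downIdx_iff] at h2
  have := Submodule.finrank_mono (le_inf h1.2.1 h2.2.1)
  omega

end StructureConstants

/-! ### The corner algebra -/

section Corner

variable {d : ℕ}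

lemma v_ne_zero : v ≠ 0 := RatFunc.X_ne_zero

lemma v_sq_pow_ne_one {m : ℕ} (hm : 0 < m) : (v ^ 2) ^ m ≠ 1 := by
  rw [← pow_mul, v, ← RatFunc.algebraMap_X, ← map_pow, ← map_one (algebraMap ℚ[X] (RatFunc ℚ))]
  intro h
  have := congrArg natDegree (RatFunc.algebraMap_injective ℚ h)
  rw [natDegree_X_pow, natDegree_one] at this
  omega

lemma qNat_v_ne_zero {n : ℕ} (hn : 0 < n) : qNat (v ^ 2) n ≠ 0 := by
  intro h
  have := sub_one_mul_qNat (v ^ 2) n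
  rw [h, mul_zero, eq_comm, sub_eq_zero] at this
  exact v_sq_pow_ne_one hn this

lemma qFact_v_ne_zero (n : ℕ) : qFact (v ^ 2) n ≠ 0 :=
  Finset.prod_ne_zero_iff.2 fun _ _ => qNat_v_ne_zero (Nat.succ_pos _)

lemma mul_apply (x y : JSchurAlgebra d) (C : Xi d) :
    (x * y) C = ∑ A, ∑ B, x A * y B * structureConst A B C := rfl

lemma mul_j_apply (x : JSchurAlgebra d) (C : Xi d) :
    (x * j d) C = if firstCol C = d then x C else 0 := by
  rw [mul_apply, Finset.sum_eq_single C, Finset.sum_eq_single (diagIdx d)]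
  · rw [structureConst_diag_right (isDiagIdx_diagIdx d)]
    change _ = if firstCol C = (diagIdx d).1 0 0 then _ else _
    simp [j, basisElt]
  · intro D _ hD
    simp [j, basisElt, hD]
  · simp
  · intro A _ hA
    refine Finset.sum_eq_zero fun D _ => ?_
    by_cases hD : D = diagIdx d
    · rw [hD, structureConst_diag_right (isDiagIdx_diagIdx d), if_neg (fun h => hA h.1), mul_zero]
    · simp [j, basisElt, hD]
  · simp

lemma j_mul_apply (x : JSchurAlgebra d) (C : Xi d) :
    (j d * x) C = if firstRow C = d then x C else 0 := by
  rw [mul_apply, Finset.sum_eq_single (diagIdx d), Finset.sum_eq_single C]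
  · rw [structureConst_diag_left (isDiagIdx_diagIdx d)]
    change _ = if firstRow C = (diagIdx d).1 0 0 then _ else _
    simp [j, basisElt]
  · intro A _ hA
    rw [structureConst_diag_left (isDiagIdx_diagIdx d), if_neg (fun h => hA h.1), mul_zero]
  · simp
  · intro D _ hD
    simp [j, basisElt, hD]
  · simp

/-- The element of the corner algebra with given coefficients. -/
def cornerMap (d : ℕ) : (ℕ → K) →ₗ[K] JSchurAlgebra d where
  toFun g := fun C => if firstRow C = d ∧ firstCol C = d then g (C.1 0 2) else 0
  map_add' g h := by
    funext C
    change (if firstRow C = d ∧ firstCol C = d then g (C.1 0 2) + h (C.1 0 2) else 0) =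
      (if firstRow C = d ∧ firstCol C = d then g (C.1 0 2) else 0) +
        (if firstRow C = d ∧ firstCol C = d then h (C.1 0 2) else 0)
    split_ifs <;> simp
  map_smul' c g := by
    funext C
    change (if firstRow C = d ∧ firstCol C = d then c * g (C.1 0 2) else 0) =
      c * (if firstRow C = d ∧ firstCol C = d then g (C.1 0 2) else 0)
    split_ifs <;> simp

lemma cornerMap_apply (g : ℕ → K) (C : Xi d) :
    cornerMap d g C = if firstRow C = d ∧ firstCol C = d then g (C.1 0 2) else 0 := rfl

lemma cornerMap_cornerIdx (g : ℕ → K) (m : Fin (d + 1)) :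
    cornerMap d g (cornerIdx d m) = g m := by
  rw [cornerMap_apply, if_pos ⟨firstRow_cornerIdx m, firstCol_cornerIdx m⟩]
  rfl

lemma cornerMap_eq_of_forall {g : ℕ → K} {x : JSchurAlgebra d}
    (h : ∀ m, x (cornerIdx d m) = g m)
    (h' : ∀ C, ¬ (firstRow C = d ∧ firstCol C = d) → x C = 0) : x = cornerMap d g := by
  funext C
  by_cases hC : firstRow C = d ∧ firstCol C = d
  · obtain ⟨hm, hC'⟩ := eq_cornerIdx hC.1 hC.2
    rw [hC', h, cornerMap_cornerIdx]
  · rw [h' C hC, cornerMap_apply, if_neg hC]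

lemma cornerMap_eq_zero {g : ℕ → K} (hg : g ∈ vanish K d) : cornerMap d g = 0 := by
  refine (cornerMap_eq_of_forall (fun m => ?_) fun _ _ => rfl).symm
  exact (hg m m.is_le).symm

lemma cornerMap_congr {g g' : ℕ → K} (h : g - g' ∈ vanish K d) :
    cornerMap d g = cornerMap d g' := by
  rw [← sub_eq_zero, ← map_sub, cornerMap_eq_zero h]

lemma j_eq_cornerMap : j d = cornerMap d (Pi.single 0 1) := by
  refine cornerMap_eq_of_forall (fun m => ?_) fun C hC => ?_
  · change (if _ then _ else _) = _
    simp only [Pi.single_apply, ← cornerIdx_zero, (cornerIdx_injective d).eq_iff, Fin.ext_iff,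
      Fin.val_zero]
  · refine if_neg ?_
    rintro rfl
    rw [← cornerIdx_zero] at hC
    exact hC ⟨firstRow_cornerIdx 0, firstCol_cornerIdx 0⟩

lemma iSchur_eq_range : iSchur d = Set.range (cornerMap d) := by
  ext x
  constructor
  · rintro ⟨s, rfl⟩
    refine ⟨fun m => if h : m < d + 1 then s (cornerIdx d ⟨m, h⟩) else 0, ?_⟩
    refine (cornerMap_eq_of_forall (fun m => ?_) fun C hC => ?_).symm
    · rw [mul_j_apply, if_pos (firstCol_cornerIdx m), j_mul_apply, if_pos (firstRow_cornerIdx m),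
        dif_pos m.is_lt]
    · rw [mul_j_apply, j_mul_apply]
      split_ifs with h1 h2
      · exact absurd ⟨h2, h1⟩ hC
      · rfl
      · rfl
  · rintro ⟨g, rfl⟩
    refine ⟨cornerMap d g, ?_⟩
    funext C
    rw [mul_j_apply, j_mul_apply, cornerMap_apply]
    split_ifs <;> tauto

lemma sum_cornerMap_mul (g : ℕ → K) (w : Xi d → K) :
    ∑ A, cornerMap d g A * w A = ∑ m ∈ Finset.range (d + 1),
      g m * if h : m < d + 1 then w (cornerIdx d ⟨m, h⟩) else 0 := by
  rw [Finset.sum_range]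
  refine (Fintype.sum_of_injective (cornerIdx d) (cornerIdx_injective d) _ _ ?_ ?_).symm
  · intro C hC
    rw [cornerMap_apply, if_neg, zero_mul]
    rintro ⟨h1, h2⟩
    obtain ⟨h, hC'⟩ := eq_cornerIdx h1 h2
    exact hC ⟨_, hC'.symm⟩
  · intro m
    rw [cornerMap_cornerIdx, dif_pos m.is_lt]

lemma sub_sum_single_mem_vanish {R : Type*} [CommRing R] (g : ℕ → R) (d : ℕ) :
    g - ∑ m ∈ Finset.range (d + 1), g m • (Pi.single m 1 : ℕ → R) ∈ vanish R d := by
  intro m hm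
  rw [Pi.sub_apply, Finset.sum_apply, Finset.sum_eq_single_of_mem m
    (Finset.mem_range.2 (by omega))]
  · simp
  · intro l _ hl
    simp [hl.symm]

/-- The operator of multiplication by the corner element with coefficients `g`. -/
def mulOp (d : ℕ) (g : ℕ → K) : Module.End K (ℕ → K) :=
  ∑ i ∈ Finset.range (d + 1), (g i / qFact (v ^ 2) i) • distOp (v ^ 2) d i

/-- The delta function at `0` represents the identity `j_d`, so an element is recovered from its
multiplication operator. -/
lemma mulOp_single_zero (g : ℕ → K) : g - mulOp d g (Pi.single 0 1) ∈ vanish K d := by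
  convert sub_sum_single_mem_vanish g d using 3
  rw [mulOp, LinearMap.sum_apply]
  refine Finset.sum_congr rfl fun i _ => ?_
  rw [LinearMap.smul_apply, distOp_single_zero, smul_smul, div_mul_cancel₀ _ (qFact_v_ne_zero i)]

lemma cornerMap_mul (g h : ℕ → K) :
    cornerMap d g * cornerMap d h = cornerMap d (mulOp d g h) := by
  refine cornerMap_eq_of_forall (fun m => ?_) fun C hC => ?_
  · rw [mul_apply]
    simp only [mul_assoc, ← Finset.mul_sum]
    rw [sum_cornerMap_mul, mulOp, LinearMap.sum_apply, Finset.sum_apply]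
    refine Finset.sum_congr rfl fun i hi => ?_
    have hi : i < d + 1 := Finset.mem_range.1 hi
    rw [dif_pos hi, sum_cornerMap_mul, LinearMap.smul_apply, Pi.smul_apply, smul_eq_mul,
      div_mul_eq_mul_div, mul_div_assoc]
    congr 1
    rw [eq_div_iff (qFact_v_ne_zero i)]
    -- Only the values of `h` on `0, …, d` matter, so `h` may be expanded in delta functions.
    have hv := distOp_mem_vanish (q := v ^ 2) i (sub_sum_single_mem_vanish h d) m m.is_le
    rw [map_sub, Pi.sub_apply, sub_eq_zero] at hv
    rw [hv, map_sum, Finset.sum_apply, Finset.sum_mul]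
    refine Finset.sum_congr rfl fun l hl => ?_
    have hl : l < d + 1 := Finset.mem_range.1 hl
    rw [dif_pos hl, map_smul, Pi.smul_apply, smul_eq_mul, mul_assoc, mul_comm _ (qFact _ _)]
    congr 1
    exact qFact_mul_structureConst ⟨i, hi⟩ ⟨l, hl⟩ m
  · rw [mul_apply]
    refine Finset.sum_eq_zero fun A _ => Finset.sum_eq_zero fun B _ => ?_
    by_cases hA : firstRow A = d ∧ firstCol A = d
    · by_cases hB : firstRow B = d ∧ firstCol B = d
      · rw [not_and_or] at hC
        rcases hC with h | h
        · rw [structureConst_eq_zero_of_row (by rw [hA.1]; exact Ne.symm h), mul_zero]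
        · rw [structureConst_eq_zero_of_col (by rw [hB.2]; exact Ne.symm h), mul_zero]
      · rw [cornerMap_apply h, if_neg hB, mul_zero, zero_mul]
    · rw [cornerMap_apply g, if_neg hA, zero_mul, zero_mul]

end Corner

/-! ### The generator -/

section Generator

variable {d : ℕ}

lemma dPow_mul_dPow (a b : Fin 3) (m n : ℤ) (C : Xi d) :
    (dPow d a m * dPow d b n) C = dPow d a m C * dPow d b n C := by
  have hdiag {a : Fin 3} {m : ℤ} {D : Xi d} (h : ¬ IsDiagIdx D) : dPow d a m D = 0 := if_neg h
  rw [mul_apply, Finset.sum_eq_single C, Finset.sum_eq_single C]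
  · by_cases hC : IsDiagIdx C
    · have h1 : C.1 0 2 = 0 := hC 0 2 (by decide)
      have h2 : C.1 1 0 = 0 := hC 1 0 (by decide)
      rw [structureConst_diag_right hC, if_pos ⟨rfl, by rw [firstCol, h1, h2]; rfl⟩, mul_one]
    · rw [hdiag hC, zero_mul, zero_mul]
  · intro D _ hDC
    by_cases hC : IsDiagIdx C
    · by_cases hD : IsDiagIdx D
      · rw [structureConst_diag_right hD, if_neg, mul_zero]
        rintro ⟨-, h⟩
        have h1 : C.1 0 2 = 0 := hC 0 2 (by decide)
        have h2 : C.1 1 0 = 0 := hC 1 0 (by decide)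
        rw [firstCol, h1, h2] at h
        refine hDC (Xi.ext_entries h.symm ?_ ?_ ?_)
        · rw [hC 0 1 (by decide), hD 0 1 (by decide)]
        · rw [h1, hD 0 2 (by decide)]
        · rw [h2, hD 1 0 (by decide)]
      · rw [hdiag hD, mul_zero, zero_mul]
    · rw [hdiag hC, zero_mul, zero_mul]
  · simp
  · intro A _ hA
    refine Finset.sum_eq_zero fun D _ => ?_
    by_cases hD : IsDiagIdx D
    · rw [structureConst_diag_right hD, if_neg (fun h => hA h.1), mul_zero]
    · rw [hdiag hD, mul_zero, zero_mul]
  · simp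

lemma eq_diagIdx {C : Xi d} (hC : IsDiagIdx C) (h : firstCol C = d) : C = diagIdx d := by
  have h1 : C.1 0 1 = 0 := hC 0 1 (by decide)
  have h2 : C.1 0 2 = 0 := hC 0 2 (by decide)
  have h3 : C.1 1 0 = 0 := hC 1 0 (by decide)
  rw [firstCol, h2, h3] at h
  exact Xi.ext_entries h h1 h2 h3

lemma dPow_diagIdx (a : Fin 3) (m : ℤ) :
    dPow d a m (diagIdx d) = v ^ (-(m * colSum (diagIdx d) a)) :=
  if_pos (isDiagIdx_diagIdx d)

lemma colSum_diagIdx_zero : colSum (diagIdx d) 0 = d := by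
  simp [colSum, diagIdx, Fin.sum_univ_three]

lemma colSum_diagIdx_one : colSum (diagIdx d) 1 = 1 := by
  simp [colSum, diagIdx, Fin.sum_univ_three]

/-- At `diag(d, 1, d)` the value of `k` is `v^(-d) · v = v^(-(d-1))`, whence the minus sign. -/
lemma torus_mul_j :
    ((v - v⁻¹)⁻¹ • (k d - kInv d)) * j d = cornerMap d (-qInt (d - 1) • Pi.single 0 1) := by
  have hval (C : Xi d) : ((v - v⁻¹)⁻¹ • (k d - kInv d)) C =
      (v - v⁻¹)⁻¹ * ((dPow d 0 1 * dPow d 1 (-1)) C - (dPow d 0 (-1) * dPow d 1 1) C) := rfl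
  rw [map_smul, ← j_eq_cornerMap]
  funext C
  rw [mul_j_apply]
  change _ = -qInt (d - 1) * (if C = diagIdx d then 1 else 0)
  by_cases hC : C = diagIdx d
  · subst hC
    have hcol : firstCol (diagIdx d) = d := by
      rw [← cornerIdx_zero]
      exact firstCol_cornerIdx 0
    rw [if_pos hcol, if_pos rfl, hval, dPow_mul_dPow, dPow_mul_dPow]
    simp only [dPow_diagIdx, colSum_diagIdx_zero, colSum_diagIdx_one]
    rw [← zpow_add₀ v_ne_zero, ← zpow_add₀ v_ne_zero, qInt, div_eq_inv_mul, mul_one]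
    have h1 : -(1 * (d : ℤ)) + -(-1 * ((1 : ℕ) : ℤ)) = -((d : ℤ) - 1) := by push_cast; ring
    have h2 : -(-1 * (d : ℤ)) + -(1 * ((1 : ℕ) : ℤ)) = (d : ℤ) - 1 := by push_cast; ring
    rw [h1, h2, ← mul_neg, neg_sub (v ^ ((d : ℤ) - 1))]
  · rw [if_neg hC, mul_zero]
    split_ifs with hcol
    · have hnd : ¬ IsDiagIdx C := fun h => hC (eq_diagIdx h hcol)
      have hdiag (a : Fin 3) (m : ℤ) : dPow d a m C = 0 := if_neg hnd
      rw [hval, dPow_mul_dPow, dPow_mul_dPow, hdiag, hdiag, zero_mul, hdiag, zero_mul, sub_zero,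
        mul_zero]
    · rfl

lemma f_ne_zero {A : Xi d} (h : f d A ≠ 0) : A.1 0 1 = 1 ∧ A.1 0 2 = 0 ∧ A.1 1 0 = 0 := by
  have hA : ∀ i j, i ≠ j → A.1 i j = if j = 1 then 1 else 0 := by
    by_contra hA
    exact h (if_neg hA)
  exact ⟨hA 0 1 (by decide), hA 0 2 (by decide), hA 1 0 (by decide)⟩

lemma e_ne_zero {A : Xi d} (h : e d A ≠ 0) : A.1 0 1 = 0 ∧ A.1 0 2 = 0 ∧ A.1 1 0 = 1 := by
  have hA : ∀ i j, i ≠ j → A.1 i j = if i = 1 then 1 else 0 := by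
    by_contra hA
    exact h (if_neg hA)
  exact ⟨hA 0 1 (by decide), hA 0 2 (by decide), hA 1 0 (by decide)⟩

lemma f_upIdx : f (d + 1) (upIdx d) = v ^ (-(d : ℤ)) := by
  rw [f, if_pos]
  · congr 2
  · intro i j hij
    fin_cases i <;> fin_cases j <;> first | exact absurd rfl hij | rfl

lemma e_downIdx : e (d + 1) (downIdx d) = v ^ (-1 : ℤ) := by
  rw [e, if_pos]
  · congr 2
  · intro i j hij
    fin_cases i <;> fin_cases j <;> first | exact absurd rfl hij | rfl

lemma fe_mul_j : (f d * e d) * j d = cornerMap d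
    (v ^ (-(d : ℤ)) • (Pi.single 1 1 + qNat (v ^ 2) d • Pi.single 0 1)) := by
  -- If the last flag is maximal, `e` forces the middle one to have dimension `d - 1` and `f` brings
  -- the first one back to dimension `d`.
  have hzero {A B C : Xi d} (hC : firstCol C = d)
      (h : f d A * e d B * structureConst A B C ≠ 0) :
      A.1 0 0 + 1 = d ∧ B.1 0 0 + 1 = d ∧ firstRow C = d := by
    obtain ⟨h12, h3⟩ := ne_zero_and_ne_zero_of_mul h
    obtain ⟨h1, h2⟩ := ne_zero_and_ne_zero_of_mul h12
    obtain ⟨a1, a2, a3⟩ := f_ne_zero h1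
    obtain ⟨b1, b2, b3⟩ := e_ne_zero h2
    have r1 : firstRow A = firstRow C := by
      by_contra h'
      exact h3 (structureConst_eq_zero_of_row h')
    have r2 : firstCol B = firstCol C := by
      by_contra h'
      exact h3 (structureConst_eq_zero_of_col h')
    have r3 : firstCol A = firstRow B := by
      by_contra h'
      exact h3 (structureConst_eq_zero_of_mid h')
    rw [← r1]
    simp only [firstRow, firstCol] at *
    omega
  refine cornerMap_eq_of_forall (fun m => ?_) fun C hC => ?_
  · rw [mul_j_apply, if_pos (firstCol_cornerIdx m), mul_apply]
    -- In rank `0` there is no hyperplane and both sides vanish. In rank `d + 1` the only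
    -- contributing pair is `upIdx d`, `downIdx d`, with weight `v^(-d) · v^(-1)`.
    rcases d with _ | d
    · obtain rfl : m = 0 := Fin.ext (Nat.lt_one_iff.1 m.is_lt)
      rw [Finset.sum_eq_zero fun A _ => Finset.sum_eq_zero fun B _ => ?_]
      · simp
      · by_contra h
        have := (hzero (firstCol_cornerIdx 0) h).1
        omega
    · have hA {A B : Xi (d + 1)} (h : f (d + 1) A * e (d + 1) B *
          structureConst A B (cornerIdx (d + 1) m) ≠ 0) : A = upIdx d ∧ B = downIdx d := by
        obtain ⟨h1, h2, -⟩ := hzero (firstCol_cornerIdx m) h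
        have h12 := (ne_zero_and_ne_zero_of_mul h).1
        obtain ⟨a1, a2, a3⟩ := f_ne_zero (ne_zero_and_ne_zero_of_mul h12).1
        obtain ⟨b1, b2, b3⟩ := e_ne_zero (ne_zero_and_ne_zero_of_mul h12).2
        exact ⟨Xi.ext_entries (Nat.succ_injective h1) a1 a2 a3,
          Xi.ext_entries (Nat.succ_injective h2) b1 b2 b3⟩
      rw [Finset.sum_eq_single (upIdx d), Finset.sum_eq_single (downIdx d)]
      · rw [f_upIdx, e_downIdx, ← zpow_add₀ v_ne_zero, ← neg_add, Pi.smul_apply, smul_eq_mul]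
        push_cast
        congr 1
        rcases Nat.lt_or_ge (m : ℕ) 2 with hm | hm
        · rcases Nat.lt_or_ge (m : ℕ) 1 with hm' | hm'
          · obtain rfl : m = 0 := Fin.ext (Nat.lt_one_iff.1 hm')
            rw [structureConst_up_down_zero]
            simp
          · obtain rfl : m = 1 := Fin.ext (show (m : ℕ) = 1 by omega)
            rw [structureConst_up_down_one]
            simp
        · rw [structureConst_up_down_of_two_le hm]
          have h0 : (m : ℕ) ≠ 0 := by omega
          have h1 : (m : ℕ) ≠ 1 := by omega
          simp [h0, h1]
      · intro B _ hB
        by_contra h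
        exact hB (hA h).2
      · simp
      · intro A _ hne
        refine Finset.sum_eq_zero fun B _ => ?_
        by_contra h
        exact hne (hA h).1
      · simp
  · rw [mul_j_apply]
    split_ifs with hcol
    · rw [mul_apply]
      refine Finset.sum_eq_zero fun A _ => Finset.sum_eq_zero fun B _ => ?_
      by_contra h
      exact hC ⟨(hzero hcol h).2.2, hcol⟩
    · rfl

/-- The operator of multiplication by the generator. -/
def genOp (d : ℕ) : Module.End K (ℕ → K) :=
  v ^ (-(d : ℤ)) • adjOp (v ^ 2) d +
    (v ^ (-(d : ℤ)) * qNat (v ^ 2) d - qInt (d - 1)) • 1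

lemma t_eq_cornerMap : t d = cornerMap d (genOp d (Pi.single 0 1)) := by
  rw [t, add_mul, fe_mul_j, torus_mul_j, ← map_add]
  congr 1
  simp only [genOp, LinearMap.add_apply, LinearMap.smul_apply, adjOp_single_zero,
    Module.End.one_apply]
  rw [smul_add, smul_smul, neg_smul, sub_smul]
  abel

lemma eigenVal_eq (d k : ℕ) (hk : k ≤ d) :
    v ^ (-(d : ℤ)) * eigenVal (v ^ 2) d k + (v ^ (-(d : ℤ)) * qNat (v ^ 2) d - qInt (d - 1)) =
      -qInt (2 * k - d - 1) := by
  obtain ⟨e, rfl⟩ := Nat.exists_eq_add_of_le hk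
  have hv := v_ne_zero
  have hv1 : v ^ 2 - 1 ≠ 0 := sub_ne_zero.2 (by simpa using v_sq_pow_ne_one one_pos)
  have hdiv (n : ℕ) : qNat (v ^ 2) n = (v ^ n * v ^ n - 1) / (v ^ 2 - 1) := by
    rw [eq_div_iff hv1, mul_comm, sub_one_mul_qNat, ← pow_mul, ← pow_add, two_mul]
  have hden : v - v⁻¹ = (v ^ 2 - 1) / v := by field_simp
  have e1 : v ^ (((k + e : ℕ) : ℤ) - 1) = v ^ k * v ^ e / v := by
    rw [zpow_sub₀ hv, zpow_natCast, pow_add, zpow_one]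
  have e2 : v ^ (2 * (k : ℤ) - ((k + e : ℕ) : ℤ) - 1) = v ^ k / (v ^ e * v) := by
    rw [show 2 * (k : ℤ) - ((k + e : ℕ) : ℤ) - 1 = k - (e + 1 : ℕ) by push_cast; ring,
      zpow_sub₀ hv, zpow_natCast, zpow_natCast, pow_succ]
  rw [eigenVal, Nat.add_sub_cancel_left, qInt, qInt, zpow_neg, zpow_neg, zpow_neg, e1, e2, hden,
    zpow_natCast, hdiv, hdiv, hdiv, pow_add]
  field_simp
  ring

lemma defPoly_eq (d : ℕ) : defPoly d = ∏ k ∈ Finset.range (d + 1),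
    (X - C (v ^ (-(d : ℤ)) * eigenVal (v ^ 2) d k +
      (v ^ (-(d : ℤ)) * qNat (v ^ 2) d - qInt (d - 1)))) := by
  -- The roots match under `i = d - k`, since `d - 1 - 2i = 2k - d - 1`.
  rw [defPoly, ← Finset.prod_range_reflect]
  refine Finset.prod_congr rfl fun k hk => ?_
  have hk : k ≤ d := Nat.lt_succ_iff.1 (Finset.mem_range.1 hk)
  rw [eigenVal_eq d k hk, C_neg, sub_neg_eq_add]
  congr 3
  rw [show d + 1 - 1 - k = d - k by omega]
  push_cast [hk]
  ring

lemma genOp_mem_vanish {g : ℕ → K} (hg : g ∈ vanish K d) : genOp d g ∈ vanish K d :=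
  add_mem (Submodule.smul_mem _ _ (adjOp_mem_vanish hg)) (Submodule.smul_mem _ _ hg)

lemma aeval_defPoly_mem_vanish : aeval (genOp d) (defPoly d) (Pi.single 0 1) ∈ vanish K d := by
  rw [defPoly_eq]
  exact aeval_prod_mem_vanish (pow_ne_zero 2 v_ne_zero) (fun _ hm => v_sq_pow_ne_one hm) d _ _

lemma natDegree_defPoly (d : ℕ) : (defPoly d).natDegree = d + 1 := by
  rw [defPoly, natDegree_prod_of_monic _ _ fun _ _ => monic_X_add_C _]
  simp

lemma commute_genOp_distOp (i : ℕ) : Commute (distOp (v ^ 2) d i) (genOp d) :=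
  ((distOp_commute _ d i).smul_right _).add_right ((Commute.one_right _).smul_right _)

lemma commute_mulOp (g : ℕ → K) (p : K[X]) : Commute (mulOp d g) (aeval (genOp d) p) := by
  refine (Commute.sum_left _ _ _ fun i _ => ?_)
  refine Commute.smul_left ?_ _
  induction p using Polynomial.induction_on' with
  | add p r hp hr => rw [map_add]; exact hp.add_right hr
  | monomial n a =>
    rw [aeval_monomial]
    exact (Algebra.commute_algebraMap_right _ _).mul_right ((commute_genOp_distOp i).pow_right n)

/-- `genOp` is affine in `adjOp` with invertible slope `v^(-d)`, and the `distOp` are polynomials in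
`adjOp`. Hence `t_d` generates the corner. -/
lemma distOp_mem_adjoin (i : ℕ) : distOp (v ^ 2) d i ∈ Algebra.adjoin K {genOp d} := by
  have hadj : adjOp (v ^ 2) d ∈ Algebra.adjoin K {genOp d} := by
    have h : adjOp (v ^ 2) d = v ^ (d : ℤ) • (genOp d -
        (v ^ (-(d : ℤ)) * qNat (v ^ 2) d - qInt (d - 1)) • 1) := by
      rw [genOp, add_sub_cancel_right, smul_smul, ← zpow_add₀ v_ne_zero, add_neg_cancel, zpow_zero,
        one_smul]
    rw [h]
    exact Subalgebra.smul_mem _ (sub_mem (Algebra.self_mem_adjoin_singleton _ _)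
      (Subalgebra.smul_mem _ (one_mem _) _)) _
  induction i using Nat.strong_induction_on with
  | _ i ih =>
    rcases i with _ | _ | i
    · exact one_mem _
    · exact hadj
    · exact sub_mem (sub_mem (mul_mem hadj (ih _ (by omega)))
        (Subalgebra.smul_mem _ (ih _ (by omega)) _)) (Subalgebra.smul_mem _ (ih _ (by omega)) _)

lemma exists_aeval_eq_mulOp (g : ℕ → K) : ∃ p : K[X], aeval (genOp d) p = mulOp d g := by
  have : mulOp d g ∈ Algebra.adjoin K {genOp d} :=
    sum_mem fun i _ => Subalgebra.smul_mem _ (distOp_mem_adjoin i) _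
  rw [Algebra.adjoin_singleton_eq_range_aeval] at this
  exact this

/-! ### The isomorphism -/

/-- The value of a polynomial at the generator of the corner algebra. -/
def evalGen (d : ℕ) : K[X] →ₗ[K] JSchurAlgebra d :=
  cornerMap d ∘ₗ LinearMap.applyₗ (Pi.single 0 1) ∘ₗ (aeval (genOp d)).toLinearMap

lemma evalGen_apply (p : K[X]) :
    evalGen d p = cornerMap d (aeval (genOp d) p (Pi.single 0 1)) := rfl

/-- Write `T` for `genOp d`, `δ` for the delta function at `0` and `g = p(T) δ`. Multiplication by
`g` commutes with `r(T)` and sends `δ` to `g` modulo `vanish`, so it sends `r(T) δ` to `r(T) p(T)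
δ`. -/
lemma evalGen_mul (p r : K[X]) : evalGen d (p * r) = evalGen d p * evalGen d r := by
  rw [evalGen_apply, evalGen_apply, evalGen_apply, cornerMap_mul]
  refine cornerMap_congr ?_
  have h := LinearMap.congr_fun (commute_mulOp (d := d)
    (aeval (genOp d) p (Pi.single 0 1)) r).eq (Pi.single 0 1)
  rw [Module.End.mul_apply, Module.End.mul_apply] at h
  rw [h, mul_comm p r, map_mul, Module.End.mul_apply, ← map_sub]
  exact aeval_mem_of_forall_mem (fun _ => genOp_mem_vanish) r (mulOp_single_zero _)

lemma evalGen_eq_zero {p : K[X]} (hp : p ∈ Ideal.span {defPoly d}) : evalGen d p = 0 := by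
  obtain ⟨r, rfl⟩ := Ideal.mem_span_singleton'.1 hp
  rw [evalGen_apply, map_mul, Module.End.mul_apply]
  exact cornerMap_eq_zero (aeval_mem_of_forall_mem (fun _ => genOp_mem_vanish) r
    aeval_defPoly_mem_vanish)

lemma exists_evalGen_eq (g : ℕ → K) : ∃ p : K[X], evalGen d p = cornerMap d g := by
  obtain ⟨p, hp⟩ := exists_aeval_eq_mulOp (d := d) g
  refine ⟨p, ?_⟩
  rw [evalGen_apply, hp]
  refine cornerMap_congr ?_
  rw [← neg_mem_iff, neg_sub]
  exact mulOp_single_zero g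

/-- The linear map induced by `evalGen` on the quotient. -/
def quotientMap (d : ℕ) : (K[X] ⧸ Ideal.span {defPoly d}) →ₗ[K] JSchurAlgebra d :=
  ((Ideal.span {defPoly d}).restrictScalars K).liftQ (evalGen d)
    (fun _ hp => evalGen_eq_zero hp) ∘ₗ
    (Submodule.Quotient.restrictScalarsEquiv K (Ideal.span {defPoly d})).symm.toLinearMap

lemma quotientMap_mk (p : K[X]) :
    quotientMap d (Ideal.Quotient.mk (Ideal.span {defPoly d}) p) = evalGen d p := rfl

/-- A surjection between spaces of dimension `d + 1` is injective; no distinctness of the roots of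
`defPoly` is needed. -/
lemma quotientMap_injective (d : ℕ) : Function.Injective (quotientMap d) := by
  have hrank : Module.finrank K (K[X] ⧸ Ideal.span {defPoly d}) = d + 1 := by
    rw [finrank_quotient_span_eq_natDegree, natDegree_defPoly]
  have : FiniteDimensional K (K[X] ⧸ Ideal.span {defPoly d}) :=
    Module.finite_of_finrank_pos (by omega)
  let coeffs : JSchurAlgebra d →ₗ[K] (Fin (d + 1) → K) :=
    { toFun := fun x m => x (cornerIdx d m)
      map_add' := fun _ _ => rfl
      map_smul' := fun _ _ => rfl }
  have hsurj : Function.Surjective (coeffs ∘ₗ quotientMap d) := by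
    intro w
    obtain ⟨p, hp⟩ := exists_evalGen_eq (d := d)
      (fun m => if h : m < d + 1 then w ⟨m, h⟩ else 0)
    refine ⟨Ideal.Quotient.mk _ p, ?_⟩
    funext m
    change quotientMap d (Ideal.Quotient.mk _ p) (cornerIdx d m) = w m
    rw [quotientMap_mk, hp, cornerMap_cornerIdx, dif_pos m.is_lt]
  have hinj := (LinearMap.injective_iff_surjective_of_finrank_eq_finrank
    (by rw [hrank, Module.finrank_fin_fun])).2 hsurj
  exact Function.Injective.of_comp (f := coeffs) hinj

end Generator

end JSchur

end

theorem mainTheorem2 (d : ℕ) :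
    ∃ φ : (Polynomial JSchur.K ⧸ Ideal.span {JSchur.defPoly d}) →ₙₐ[JSchur.K] JSchurAlgebra d,
      Function.Injective φ ∧
      Set.range φ = JSchur.iSchur d ∧
      φ 1 = JSchur.j d ∧
      φ (Ideal.Quotient.mk (Ideal.span {JSchur.defPoly d}) Polynomial.X) = JSchur.t d := by
  refine ⟨{ toFun := JSchur.quotientMap d
            map_smul' := fun c x => map_smul (JSchur.quotientMap d) c x
            map_zero' := map_zero (JSchur.quotientMap d)
            map_add' := map_add (JSchur.quotientMap d)
            map_mul' := fun x y => ?_ }, JSchur.quotientMap_injective d, ?_, ?_, ?_⟩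
  · obtain ⟨p, rfl⟩ := Ideal.Quotient.mk_surjective x
    obtain ⟨r, rfl⟩ := Ideal.Quotient.mk_surjective y
    rw [← map_mul]
    exact JSchur.evalGen_mul p r
  · rw [JSchur.iSchur_eq_range]
    refine Set.Subset.antisymm ?_ ?_
    · rintro _ ⟨x, rfl⟩
      obtain ⟨p, rfl⟩ := Ideal.Quotient.mk_surjective x
      exact ⟨_, (JSchur.evalGen_apply p).symm⟩
    · rintro _ ⟨g, rfl⟩
      obtain ⟨p, hp⟩ := JSchur.exists_evalGen_eq (d := d) g
      exact ⟨Ideal.Quotient.mk _ p, hp⟩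
  · change JSchur.evalGen d 1 = _
    rw [JSchur.evalGen_apply, map_one, Module.End.one_apply, JSchur.j_eq_cornerMap]
  · change JSchur.evalGen d Polynomial.X = _
    rw [JSchur.evalGen_apply, Polynomial.aeval_X, JSchur.t_eq_cornerMap]
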